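/- Theorem 1.4. Let $\mathcal M_1,\mathcal M_2$ be two matroids on the same $n$-element ground set $V$ and $w:V\to\mathbb Z$ an integer weight function. Let $W=\max_{e\in V}|w(e)|$ (with $W=0$ if $V=\emptyset$) and let $r$ be the maximum cardinality of a common independent set (read as $1$ if $\emptyset$ is the only common independent set). The weighted matroid intersection problem asks for a set $S$ that is independent in both matroids and maximizes $\sum_{e\in S}w(e)$. A parallel query algorithm knows $V$ and $w$, and accesses the matroids only through oracles, in rounds; in each round it may issue a number of queries to the oracles of $\mathcal M_1$ and $\mathcal M_2$ that is bounded by a fixed polynomial in $n$, and these queries may depend on the answers of earlier rounds only. An independence query asks of a set $X\subseteq V$ whether it is independent in $\mathcal M_i$; a rank query asks for the rank of $X$ in $\mathcal M_i$. Write $\log^+x=\max\{1,\log x\}$ for $x>0$ and $\log^+0=1$. There are deterministic parallel query algorithms which, on every such input, output an optimal solution of weighted matroid intersection, one using $$O\bigl(n^{1/3}r^{1/3}\log^+(Wr)\bigr)$$ rounds of rank queries, and one using $$O\bigl(n^{1/3}r^{1/2}\log^+(Wr)\,\log^+(n/r)\bigr)$$ rounds of independence queries. The implied constants and the polynomial are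 absolute, i.e. independent of $n$, $r$, $W$, $w$ and the matroids. -/

import Mathlib

/-!
If `w = w₁ + w₂` and a common base `S` has maximum weight for `w₁` among the bases of `M₁` and for
`w₂` among the bases of `M₂`, then `S` is a common base of maximum weight for `w`. To treat common
independent sets of size at most `k` instead of common bases, add `k` free elements of weight `0`
to each matroid and truncate to rank `k`.

Scaling halves the precision `δ` from phase to phase. A phase starts from a splitting that is
optimal for the previous precision and forgets its bases. In each round of an auction, the
elements of `S₁ \ S₂` that have been raised less than `2 * d` times are raised in parallel by `δ`,
where `S₁` and `S₂` are greedy bases for the current weights. As soon as at most `k / d` elements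
are raised, and hence after about `n * d ^ 2 / k` rounds, the auction stops. Near-optimality of
the old splitting bounds the total raise over `S₁ \ S₂` by `O(k)`, in units of `δ`, so that
`S₁ \ S₂` has only `O(k / d)` elements. They are eliminated one at a time by shortest
augmenting paths along tight exchanges, which take one round of queries each. If greedy bases
take `t` rounds, the best choice of `d` makes the cost of a phase
`O((n * k * t) ^ (1 / 3) + t)` rounds.

With rank queries greedy bases take one round. With independence queries they reduce to computing
ranks, and thus to finding a basis of a set: arrange its elements in columns of length about `√k`,
and test all initial segments of all columns in parallel. Finally, `r` is found by doubling `k`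
with unit weights.
-/

/-- A deterministic adaptive algorithm with parallel access to an oracle. It either stops with an
output, or issues a round of `m` queries `q 0, …, q (m - 1)` simultaneously, and continues in a way
that depends on all the answers of that round. Here `Q`, `A`, `O` are the types of queries, answers
and outputs. -/
inductive ParallelAlg (Q A O : Type) : Type
  | done (out : O) : ParallelAlg Q A O
  | round (m : ℕ) (q : Fin m → Q) (next : (Fin m → A) → ParallelAlg Q A O) : ParallelAlg Q A O

namespace ParallelAlg

variable {Q A O : Type}

/-- The output of the algorithm when queries are answered by `oracle`. -/
def output (oracle : Q → A) : ParallelAlg Q A O → O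
  | done out => out
  | round _ q next => (next fun i => oracle (q i)).output oracle

/-- The number of rounds of queries made when queries are answered by `oracle`. -/
def rounds (oracle : Q → A) : ParallelAlg Q A O → ℕ
  | done _ => 0
  | round _ q next => (next fun i => oracle (q i)).rounds oracle + 1

/-- The largest number of queries made in a single round when queries are answered by `oracle`. -/
def width (oracle : Q → A) : ParallelAlg Q A O → ℕ
  | done _ => 0
  | round m q next => max m ((next fun i => oracle (q i)).width oracle)

end ParallelAlg

namespace MatroidIntersection

/-- A query is a subset of the ground set, addressed to the first matroid (`Sum.inl`) or to the
second one (`Sum.inr`). -/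
abbrev Query (n : ℕ) : Type := Finset (Fin n) ⊕ Finset (Fin n)

/-- A parallel algorithm with access to independence oracles of two matroids on `Fin n`, which
outputs a subset of `Fin n`. -/
abbrev IndepAlg (n : ℕ) : Type := ParallelAlg (Query n) Bool (Finset (Fin n))

/-- A parallel algorithm with access to rank oracles of two matroids on `Fin n`, which outputs a
subset of `Fin n`. -/
abbrev RankAlg (n : ℕ) : Type := ParallelAlg (Query n) ℕ (Finset (Fin n))

open Classical in
/-- The independence oracles of `M₁` and `M₂`. -/
noncomputable def indepOracle {n : ℕ} (M₁ M₂ : Matroid (Fin n)) : Query n → Bool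
  | Sum.inl S => decide (M₁.Indep (S : Set (Fin n)))
  | Sum.inr S => decide (M₂.Indep (S : Set (Fin n)))

/-- The rank oracles of `M₁` and `M₂` (all ranks are finite as `Fin n` is). -/
noncomputable def rankOracle {n : ℕ} (M₁ M₂ : Matroid (Fin n)) : Query n → ℕ
  | Sum.inl S => (M₁.eRk (S : Set (Fin n))).toNat
  | Sum.inr S => (M₂.eRk (S : Set (Fin n))).toNat

/-- `S` is independent in both matroids. -/
def CommonIndep {n : ℕ} (M₁ M₂ : Matroid (Fin n)) (S : Finset (Fin n)) : Prop :=
  M₁.Indep (S : Set (Fin n)) ∧ M₂.Indep (S : Set (Fin n))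

/-- `S` is a common independent set of maximum weight. -/
def IsMaxWeight {n : ℕ} (M₁ M₂ : Matroid (Fin n)) (w : Fin n → ℤ) (S : Finset (Fin n)) : Prop :=
  CommonIndep M₁ M₂ S ∧ ∀ T, CommonIndep M₁ M₂ T → ∑ e ∈ T, w e ≤ ∑ e ∈ S, w e

open Classical in
/-- The maximum cardinality of a common independent set. -/
noncomputable def commonRank {n : ℕ} (M₁ M₂ : Matroid (Fin n)) : ℕ :=
  (Finset.univ.filter fun S : Finset (Fin n) => CommonIndep M₁ M₂ S).sup Finset.card

/-- The largest absolute value of a weight (`0` if the ground set is empty). -/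
def maxAbsWeight {n : ℕ} (w : Fin n → ℤ) : ℕ := Finset.univ.sup fun e => (w e).natAbs

end MatroidIntersection

namespace ParallelAlg

variable {Q Q' A A' O P S : Type}

/-- Sequential composition: run an algorithm and feed its output to the next one. -/
def bind : ParallelAlg Q A O → (O → ParallelAlg Q A P) → ParallelAlg Q A P
  | done x, f => f x
  | round m q next, f => round m q fun a => (next a).bind f

/-- Postprocess the output. -/
def map (f : O → P) (a : ParallelAlg Q A O) : ParallelAlg Q A P := a.bind fun x => done (f x)

/-- The algorithm that asks one query and returns the answer. -/
def query (q : Q) : ParallelAlg Q A A := round 1 (fun _ => q) fun a => done (a 0)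

/-- Parallel composition: the `i`-th rounds of both algorithms are merged into one round. -/
def par : ParallelAlg Q A O → ParallelAlg Q A P → ParallelAlg Q A (O × P)
  | done x, b => b.map (Prod.mk x)
  | round m q next, done y => round m q fun a => (next a).par (done y)
  | round m q next, round m' q' next' =>
      round (m + m') (Fin.append q q') fun a =>
        (next fun i => a (i.castAdd m')).par (next' fun i => a (i.natAdd m))

/-- Parallel composition of `n` algorithms. -/
def parFin : (n : ℕ) → (Fin n → ParallelAlg Q A O) → ParallelAlg Q A (Fin n → O)
  | 0, _ => done Fin.elim0
  | n + 1, a => ((a 0).par (parFin n fun i => a i.succ)).map fun x => Fin.cons x.1 x.2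

/-- Parallel composition of a finite family of algorithms. -/
noncomputable def all {ι : Type} [Fintype ι] (a : ι → ParallelAlg Q A O) :
    ParallelAlg Q A (ι → O) :=
  (parFin (Fintype.card ι) (a ∘ (Fintype.equivFin ι).symm)).map (· ∘ Fintype.equivFin ι)

/-- Run `f` for `n` times, feeding it its own output. -/
def iter (f : S → ParallelAlg Q A S) : ℕ → S → ParallelAlg Q A S
  | 0, s => done s
  | n + 1, s => (f s).bind (iter f n)

/-- Run an algorithm with an oracle for other queries: `f` translates the queries of the algorithm
and `g q` translates back the answer to `f q`. -/
def simulate (f : Q → Q') (g : Q → A' → A) : ParallelAlg Q A O → ParallelAlg Q' A' O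
  | done x => done x
  | round m q next => round m (fun i => f (q i)) fun a => (next fun i => g (q i) (a i)).simulate f g

/-- Hoare-style specification: with oracle `o` the output satisfies `P`, and it is found within
`t` rounds of at most `c` queries. -/
structure Spec (o : Q → A) (a : ParallelAlg Q A O) (t : ℝ) (c : ℕ) (P : O → Prop) : Prop where
  output : P (a.output o)
  rounds : (a.rounds o : ℝ) ≤ t
  width : a.width o ≤ c

variable {o : Q → A}

lemma output_bind (a : ParallelAlg Q A O) (f : O → ParallelAlg Q A P) :
    (a.bind f).output o = (f (a.output o)).output o := by
  induction a with
  | done x => rfl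
  | round _ _ _ ih => exact ih _

lemma rounds_bind (a : ParallelAlg Q A O) (f : O → ParallelAlg Q A P) :
    (a.bind f).rounds o = a.rounds o + (f (a.output o)).rounds o := by
  induction a with
  | done x => simp only [bind, rounds, output, zero_add]
  | round m q next ih => simp only [bind, rounds, output, ih, add_right_comm]

lemma width_bind (a : ParallelAlg Q A O) (f : O → ParallelAlg Q A P) :
    (a.bind f).width o = max (a.width o) ((f (a.output o)).width o) := by
  induction a with
  | done x => simp only [bind, width, output, zero_le, sup_of_le_right]
  | round m q next ih => simp only [bind, width, output, ih, max_assoc]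

namespace Spec

variable {a : ParallelAlg Q A O} {t t' : ℝ} {c c' : ℕ} {R : O → Prop} {R' : P → Prop}

lemma done {x : O} (ht : 0 ≤ t) (hx : R x) : (done x : ParallelAlg Q A O).Spec o t c R :=
  ⟨hx, by simpa only [ParallelAlg.rounds, Nat.cast_zero] using ht, Nat.zero_le c⟩

lemma mono {R' : O → Prop} (h : a.Spec o t c R) (ht : t ≤ t') (hc : c ≤ c')
    (hR : ∀ x, R x → R' x) : a.Spec o t' c' R' :=
  ⟨hR _ h.output, h.rounds.trans ht, h.width.trans hc⟩

lemma nonneg (h : a.Spec o t c R) : 0 ≤ t := (Nat.cast_nonneg _).trans h.rounds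

lemma bind {f : O → ParallelAlg Q A P} (ha : a.Spec o t c R)
    (hf : ∀ x, R x → (f x).Spec o t' c R') : (a.bind f).Spec o (t + t') c R' := by
  have hf := hf _ ha.output
  refine ⟨output_bind a f ▸ hf.output, ?_, ?_⟩
  · rw [rounds_bind, Nat.cast_add]
    exact add_le_add ha.rounds hf.rounds
  · exact width_bind a f ▸ max_le ha.width hf.width

lemma map {f : O → P} (ha : a.Spec o t c R) (hf : ∀ x, R x → R' (f x)) :
    (a.map f).Spec o t c R' :=
  add_zero t ▸ ha.bind fun x hx => done le_rfl (hf x hx)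

lemma query (q : Q) : (query q : ParallelAlg Q A A).Spec o 1 1 (· = o q) :=
  ⟨rfl, by simp [ParallelAlg.query, ParallelAlg.rounds],
    by simp [ParallelAlg.query, ParallelAlg.width]⟩

lemma of_round {m : ℕ} {q : Fin m → Q} {next : (Fin m → A) → ParallelAlg Q A O}
    (h : (round m q next).Spec o t c R) :
    m ≤ c ∧ (next fun i => o (q i)).Spec o (t - 1) c R := by
  obtain ⟨hx, ht, hc⟩ := h
  rw [ParallelAlg.rounds, Nat.cast_add, Nat.cast_one] at ht
  rw [ParallelAlg.width, max_le_iff] at hc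
  exact ⟨hc.1, hx, le_sub_iff_add_le.mpr ht, hc.2⟩

lemma round {m : ℕ} {q : Fin m → Q} {next : (Fin m → A) → ParallelAlg Q A O} (hm : m ≤ c)
    (h : (next fun i => o (q i)).Spec o (t - 1) c R) : (round m q next).Spec o t c R := by
  refine ⟨h.output, ?_, max_le hm h.width⟩
  rw [ParallelAlg.rounds, Nat.cast_add, Nat.cast_one]
  exact le_sub_iff_add_le.mp h.rounds

lemma par {b : ParallelAlg Q A P} (ha : a.Spec o t c R) (hb : b.Spec o t c' R') :
    (a.par b).Spec o t (c + c') fun x => R x.1 ∧ R' x.2 := by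
  induction a generalizing b t with
  | done x =>
    exact (hb.mono le_rfl (Nat.le_add_left c' c) fun _ => id).map fun y hy => ⟨ha.output, hy⟩
  | round m q next ih =>
    obtain ⟨hm, ha'⟩ := ha.of_round
    cases b with
    | done y =>
      exact round (hm.trans (Nat.le_add_right c c')) (ih _ ha' (done ha'.nonneg hb.output))
    | round m' q' next' =>
      obtain ⟨hm', hb'⟩ := hb.of_round
      refine round (add_le_add hm hm') ?_
      simp only [Fin.append_left, Fin.append_right]
      exact ih _ ha' hb'

lemma parFin {n : ℕ} {a : Fin n → ParallelAlg Q A O} {R : Fin n → O → Prop} (ht : 0 ≤ t)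
    (h : ∀ i, (a i).Spec o t c (R i)) :
    (parFin n a).Spec o t (n * c) fun x => ∀ i, R i (x i) := by
  induction n with
  | zero => exact done ht fun i => i.elim0
  | succ n ih =>
    rw [Nat.succ_mul, add_comm (n * c)]
    exact ((h 0).par (ih fun i => h i.succ)).map fun x hx => Fin.cases hx.1 hx.2

lemma all {ι : Type} [Fintype ι] {a : ι → ParallelAlg Q A O} {R : ι → O → Prop} (ht : 0 ≤ t)
    (h : ∀ i, (a i).Spec o t c (R i)) :
    (all a).Spec o t (Fintype.card ι * c) fun x => ∀ i, R i (x i) := by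
  refine (parFin ht fun i => h ((Fintype.equivFin ι).symm i)).map fun x hx i => ?_
  simpa only [Function.comp_apply, Equiv.symm_apply_apply] using hx (Fintype.equivFin ι i)

lemma iter {f : S → ParallelAlg Q A S} {I : ℕ → S → Prop}
    (hf : ∀ i s, I i s → (f s).Spec o t c (I (i + 1))) (n : ℕ) {s : S} (hs : I 0 s) :
    (iter f n s).Spec o (n * t) c (I n) := by
  induction n generalizing s I with
  | zero => exact done (by rw [Nat.cast_zero, zero_mul]) hs
  | succ n ih =>
    refine ((hf 0 s hs).bind fun s hs => ih (I := fun i => I (i + 1)) (fun i => hf (i + 1)) hs).mono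
      (le_of_eq ?_) le_rfl fun _ => id
    push_cast
    ring

lemma simulate {a : ParallelAlg Q' A' O} {f : Q' → Q} {g : Q' → A → A'}
    (h : a.Spec (fun q => g q (o (f q))) t c R) : (a.simulate f g).Spec o t c R := by
  induction a generalizing t with
  | done x => exact done h.nonneg h.output
  | round m q next ih => exact round h.of_round.1 (ih _ h.of_round.2)

end Spec

end ParallelAlg

namespace MatroidIntersection

section MaxWeightBase

variable {α : Type*} {M : Matroid α} {u v : α → ℤ} {S T : Finset α} {k : ℕ} {δ ε : ℤ}

/-- `S` is a base of `M` of maximum weight. -/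
def IsMaxBase (M : Matroid α) (w : α → ℤ) (S : Finset α) : Prop :=
  M.IsBase S ∧ ∀ T : Finset α, M.IsBase T → ∑ e ∈ T, w e ≤ ∑ e ∈ S, w e

lemma card_eq_of_isBase (hS : M.IsBase S) (hk : M.eRank = k) : S.card = k := by
  rw [← hS.encard_eq_eRank, Set.encard_coe_eq_coe_finsetCard] at hk
  exact_mod_cast hk

/-- If two weight functions differ by about `δ * f`, then the second one prefers bases with many
elements of large `f`. -/
lemma IsMaxBase.sum_le_sum_add (hS : IsMaxBase M u S) (hT : IsMaxBase M v T) (hk : M.eRank = k)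
    (hδ : 0 < δ) {f : α → ℤ} (hf : ∀ e, |v e - u e - δ * f e| ≤ ε * δ) :
    ∑ e ∈ S, f e ≤ ∑ e ∈ T, f e + 2 * ε * k := by
  have hvS := hT.2 S hS.1
  have huT := hS.2 T hT.1
  have hfS : ∑ e ∈ S, δ * f e ≤ ∑ e ∈ S, (v e - u e + ε * δ) :=
    Finset.sum_le_sum fun e _ => by linarith [(abs_le.1 (hf e)).1]
  have hfT : ∑ e ∈ T, (v e - u e - ε * δ) ≤ ∑ e ∈ T, δ * f e :=
    Finset.sum_le_sum fun e _ => by linarith [(abs_le.1 (hf e)).2]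
  simp only [Finset.sum_add_distrib, Finset.sum_sub_distrib, Finset.sum_const, nsmul_eq_mul,
    ← Finset.mul_sum, card_eq_of_isBase hS.1 hk, card_eq_of_isBase hT.1 hk] at hfS hfT
  refine le_of_mul_le_mul_left ?_ hδ
  linarith

end MaxWeightBase

section Exchange

variable {α ι : Type*} [DecidableEq α] {M : Matroid α} {w : α → ℤ} {S T : Finset α} {a b x y : α}

/-- Exchanging `a ∈ S` for `b ∉ S` turns `S` into a base: the arcs of the exchange graph. -/
def IsExchange (M : Matroid α) (S : Finset α) (a b : α) : Prop :=
  a ∈ S ∧ b ∉ S ∧ M.IsBase (insert b (S.erase a) : Finset α)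

lemma isExchange_iff (hS : M.IsBase S) :
    IsExchange M S a b ↔ a ∈ S ∧ b ∉ S ∧ b ∈ M.E \ M.closure (S \ {a}) := by
  refine and_congr_right fun ha => and_congr_right fun hb => ?_
  rw [Finset.coe_insert, Finset.coe_erase]
  refine ⟨fun h => ⟨h.subset_ground (Set.mem_insert _ _), ?_⟩,
    fun h => hS.exchange_base_of_notMem_closure ha h.2 h.1⟩
  have hb' : b ∉ (S : Set α) \ {a} := fun hb' => hb hb'.1
  have := h.indep.notMem_closure_sdiff_of_mem (Set.mem_insert _ _)
  rwa [Set.insert_sdiff_self_of_notMem hb'] at this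

lemma IsExchange.sum_add (h : IsExchange M S a b) (w : α → ℤ) :
    ∑ e ∈ insert b (S.erase a), w e + w a = ∑ e ∈ S, w e + w b := by
  rw [Finset.sum_insert fun hb => h.2.1 (Finset.mem_of_mem_erase hb),
    ← Finset.add_sum_erase S w h.1]
  ring

lemma IsMaxBase.le_of_isExchange (hS : IsMaxBase M w S) (h : IsExchange M S a b) : w b ≤ w a := by
  linarith [h.sum_add w, hS.2 _ h.2.2]

lemma IsMaxBase.exchange (hS : IsMaxBase M w S) (h : IsExchange M S a b) (hw : w a = w b) :
    IsMaxBase M w (insert b (S.erase a)) :=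
  ⟨h.2.2, fun T hT => by linarith [h.sum_add w, hS.2 T hT]⟩

lemma exists_symm_exchange (hS : M.IsBase S) (hT : M.IsBase T) (hbT : b ∈ T) (hbS : b ∉ S) :
    ∃ a, IsExchange M S a b ∧ IsExchange M T b a := by
  have hC := hS.fundCircuit_isCircuit (hT.subset_ground hbT) hbS
  obtain ⟨a, ⟨haC, hab : a ≠ b⟩, haT⟩ :
      ∃ a ∈ M.fundCircuit b S \ {b}, a ∉ M.closure (T \ {b}) := by
    by_contra! h
    exact hT.indep.notMem_closure_sdiff_of_mem hbT (M.closure_subset_closure_of_subset_closure h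
      (hC.mem_closure_sdiff_singleton_of_mem (M.mem_fundCircuit b S)))
  have haS : a ∈ S := (M.fundCircuit_subset_insert b S haC).resolve_left hab
  have haE : a ∈ M.E := hS.subset_ground haS
  have haT' : a ∉ T := fun h => haT (M.mem_closure_of_mem' ⟨h, hab⟩ haE)
  refine ⟨a, ⟨haS, hbS, ?_⟩, (isExchange_iff hT).2 ⟨hbT, haT', haE, haT⟩⟩
  rw [hS.indep.mem_fundCircuit_iff (hS.closure_eq.symm ▸ hT.subset_ground hbT) hbS,
    ← Set.insert_sdiff_singleton_comm hab.symm] at haC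
  rw [Finset.coe_insert, Finset.coe_erase]
  exact hS.exchange_isBase_of_indep hbS haC

lemma sum_le_of_forall_isExchange (hS : M.IsBase S) (h : ∀ a b, IsExchange M S a b → w b ≤ w a)
    (hT : M.IsBase T) : ∑ e ∈ T, w e ≤ ∑ e ∈ S, w e := by
  induction hn : (T \ S).card using Nat.strong_induction_on generalizing T with
  | _ n ih =>
  by_cases hTS : T ⊆ S
  · rw [Finset.coe_injective (hT.eq_of_subset_isBase hS (Finset.coe_subset.mpr hTS))]
  obtain ⟨b, hbT, hbS⟩ := Finset.not_subset.mp hTS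
  obtain ⟨a, hSab, hTba⟩ := exists_symm_exchange hS hT hbT hbS
  have hcard : (insert a (T.erase b) \ S).card < n := by
    rw [← hn, Finset.insert_sdiff_of_mem _ hSab.1, Finset.erase_sdiff_comm]
    exact Finset.card_erase_lt_of_mem (Finset.mem_sdiff.mpr ⟨hbT, hbS⟩)
  linarith [ih _ hcard hTba.2.2 rfl, hTba.sum_add w, h a b hSab]

lemma isMaxBase_iff :
    IsMaxBase M w S ↔ M.IsBase S ∧ ∀ a b, IsExchange M S a b → w b ≤ w a :=
  ⟨fun h => ⟨h.1, fun _ _ => h.le_of_isExchange⟩,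
    fun h => ⟨h.1, fun _ => sum_le_of_forall_isExchange h.1 h.2⟩⟩

/-- If `x` cannot be exchanged for `b`, then exchanging `a` for `b` does not change the span of
`S \ {x}`, hence not the possible exchanges of `x`. -/
lemma IsExchange.isExchange_iff_of_not (hS : M.IsBase S) (hab : IsExchange M S a b) (hx : x ∈ S)
    (hxb : ¬IsExchange M S x b) (hy : y ∉ S) (hyb : y ≠ b) :
    IsExchange M (insert b (S.erase a)) x y ↔ IsExchange M S x y := by
  have hxa : x ≠ a := fun h => hxb (h ▸ hab)
  have hbx : b ≠ x := fun h => hab.2.1 (h ▸ hx)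
  have hb := ((isExchange_iff hS).1 hab).2.2
  have hspan : M.closure ((insert b (S.erase a) : Finset α) \ {x}) = M.closure (S \ {x}) := by
    set X : Set α := (S \ {x}) \ {a} with hX
    have hX₁ : ↑(insert b (S.erase a)) \ {x} = insert b X := by
      rw [Finset.coe_insert, Finset.coe_erase, ← Set.insert_sdiff_singleton_comm hbx,
        Set.sdiff_sdiff_comm]
    have hX₂ : (S : Set α) \ {x} = insert a X := by
      rw [hX, Set.insert_sdiff_singleton,
        Set.insert_eq_of_mem (Set.mem_sdiff_singleton.mpr ⟨hab.1, hxa.symm⟩)]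
    have hXb : b ∉ M.closure X := fun h =>
      hb.2 (M.closure_subset_closure (Set.sdiff_subset_sdiff_left Set.sdiff_subset) h)
    have hxb : b ∈ M.closure (S \ {x}) :=
      by_contra fun h => hxb ((isExchange_iff hS).2 ⟨hx, hab.2.1, hb.1, h⟩)
    rw [hX₂] at hxb ⊢
    rw [hX₁, Matroid.closure_insert_congr ⟨hxb, hXb⟩]
  rw [isExchange_iff hab.2.2, isExchange_iff hS, hspan]
  simp only [Finset.mem_insert, Finset.mem_erase, hx, hy, hxa, hyb, ne_eq, not_false_eq_true,
    and_self, or_true, and_false, or_self, true_and]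

lemma IsMaxBase.exchange_image {K : Type*} [LinearOrder K] (hS : IsMaxBase M w S)
    {I : Finset ι} {a b : ι → α} (f : ι → K) (hab : ∀ i ∈ I, IsExchange M S (a i) (b i))
    (hw : ∀ i ∈ I, w (a i) = w (b i))
    (htri : ∀ i ∈ I, ∀ j ∈ I, j ≠ i → f j ≤ f i → ¬IsExchange M S (a j) (b i)) :
    IsMaxBase M w (S \ I.image a ∪ I.image b) := by
  classical
  induction I using Finset.induction_on_max_value f generalizing S with
  | empty => simpa only [Finset.image_empty, Finset.sdiff_empty, Finset.union_empty] using hS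
  | insert i I hi hmax ih =>
    have hne : ∀ j ∈ I, j ≠ i := fun j hj h => hi (h ▸ hj)
    obtain ⟨hiex, hab⟩ := (Finset.forall_mem_insert ..).mp hab
    obtain ⟨hwi, hw⟩ := (Finset.forall_mem_insert ..).mp hw
    have hnot : ∀ j ∈ I, ¬IsExchange M S (a j) (b i) := fun j hj =>
      htri i (I.mem_insert_self i) j (Finset.mem_insert_of_mem hj) (hne j hj) (hmax j hj)
    have hiff : ∀ j ∈ I, ∀ l ∈ I,
        (IsExchange M (insert (b i) (S.erase (a i))) (a j) (b l) ↔ IsExchange M S (a j) (b l)) :=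
      fun j hj l hl => hiex.isExchange_iff_of_not hS.1 (hab j hj).1 (hnot j hj) (hab l hl).2.1
        fun h => hnot l hl (h ▸ hab l hl)
    have := ih (hS.exchange hiex hwi) (fun j hj => (hiff j hj j hj).2 (hab j hj)) hw
      fun j hj l hl hlj hle => mt (hiff l hl j hj).1 (htri j (Finset.mem_insert_of_mem hj) l
        (Finset.mem_insert_of_mem hl) hlj hle)
    have hbi : b i ∉ I.image a := fun h => by
      obtain ⟨j, hj, hji⟩ := Finset.mem_image.mp h
      exact hiex.2.1 (hji ▸ (hab j hj).1)
    convert this using 1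
    rw [Finset.image_insert, Finset.image_insert, Finset.insert_sdiff_of_notMem _ hbi,
      Finset.insert_union, Finset.union_insert, Finset.sdiff_insert, Finset.erase_sdiff_comm]

/-- Sorting the exchanges by weight, only those between elements of the same weight can violate
triangularity. -/
lemma IsMaxBase.exchange_image_of_tight {K : Type*} [LinearOrder K]
    (hS : IsMaxBase M w S) {I : Finset ι} {a b : ι → α} {g : ι → K} (hg : g.Injective)
    (hab : ∀ i ∈ I, IsExchange M S (a i) (b i)) (hw : ∀ i ∈ I, w (a i) = w (b i))
    (htri : ∀ i ∈ I, ∀ j ∈ I, g j < g i → w (a j) = w (b i) → ¬IsExchange M S (a j) (b i)) :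
    IsMaxBase M w (S \ I.image a ∪ I.image b) := by
  refine hS.exchange_image (fun i => toLex (w (a i), g i)) hab hw fun i hi j hj hji hle hex => ?_
  obtain hlt | ⟨heq, hle⟩ := Prod.Lex.toLex_le_toLex.mp hle
  · exact (hS.le_of_isExchange hex).not_gt ((hw i hi) ▸ hlt)
  · exact htri i hi j hj (hle.lt_of_ne (hg.ne hji)) (heq.trans (hw i hi)) hex

end Exchange

section ShortestPath

variable {α : Type*} {r : α → α → Prop} {x y : α} {m : ℕ} {v : ℕ → α}

/-- `v 0, …, v m` is a path from `x` to `y` in the digraph `r`. -/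
def IsPath (r : α → α → Prop) (x y : α) (m : ℕ) (v : ℕ → α) : Prop :=
  v 0 = x ∧ v m = y ∧ ∀ i < m, r (v i) (v (i + 1))

lemma exists_isPath_of_reflTransGen (h : Relation.ReflTransGen r x y) :
    ∃ m v, IsPath r x y m v := by
  induction h with
  | refl => exact ⟨0, fun _ => x, rfl, rfl, fun i hi => absurd hi i.not_lt_zero⟩
  | @tail y z _ hyz ih =>
    obtain ⟨m, v, h0, rfl, hv⟩ := ih
    refine ⟨m + 1, fun i => if i ≤ m then v i else z, by simpa using h0, by simp, fun i hi => ?_⟩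
    obtain hlt | rfl := (Nat.lt_succ_iff.mp hi).lt_or_eq
    · simpa only [hlt.le, Nat.succ_le_of_lt hlt, if_true] using hv i hlt
    · simpa using hyz

lemma IsPath.shortcut (h : IsPath r x y m v) {i k : ℕ} (hik : i + 1 + k ≤ m)
    (hr : r (v i) (v (i + 1 + k))) :
    IsPath r x y (m - k) fun l => if l ≤ i then v l else v (l + k) := by
  obtain ⟨h0, hm, hv⟩ := h
  refine ⟨by simpa using h0, ?_, fun l hl => ?_⟩
  · simpa only [show ¬m - k ≤ i by lia, if_false, show m - k + k = m by lia] using hm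
  · obtain hli | rfl | hil := lt_trichotomy l i
    · simpa only [hli.le, Nat.succ_le_of_lt hli, if_true] using hv l (by lia)
    · simpa using hr
    · simpa only [hil.not_ge, (hil.trans l.lt_succ_self).not_ge, if_false, add_right_comm l 1 k]
        using hv (l + k) (by lia)

lemma exists_isPath_injOn_chordless (h : Relation.ReflTransGen r x y) :
    ∃ m v, IsPath r x y m v ∧ Set.InjOn v (Set.Iic m) ∧
      ∀ i j, i + 1 < j → j ≤ m → ¬r (v i) (v j) := by
  classical
  have hex := exists_isPath_of_reflTransGen h
  obtain ⟨v, hv⟩ := Nat.find_spec hex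
  have hmin : ∀ m v, IsPath r x y m v → Nat.find hex ≤ m := fun m v h => Nat.find_min' hex ⟨v, h⟩
  generalize Nat.find hex = n at hv hmin
  have hshort : ∀ i j, i + 1 < j → j ≤ n → ¬r (v i) (v j) := fun i j hij hjn hr => by
    obtain ⟨k, rfl⟩ := Nat.exists_eq_add_of_lt hij
    have := hmin _ _ (hv.shortcut (k := k + 1) (by lia) hr)
    lia
  have hne : ∀ i j, i < j → j ≤ n → v i ≠ v j := fun i j hij hjn he => by
    obtain hjn | rfl := hjn.lt_or_eq
    · exact hshort i (j + 1) (by lia) hjn (he ▸ hv.2.2 j hjn)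
    · exact (hmin i v ⟨hv.1, he.trans hv.2.1, fun l hl => hv.2.2 l (hl.trans hij)⟩).not_gt hij
  refine ⟨n, v, hv, fun i hi j hj he => ?_, hshort⟩
  obtain hij | rfl | hji := lt_trichotomy i j
  · exact absurd he (hne i j hij hj)
  · rfl
  · exact absurd he.symm (hne j i hji hi)

end ShortestPath

/-- Two weight functions and, for each of them, a base of the corresponding matroid. -/
structure Splitting (α : Type*) where
  w₁ : α → ℤ
  w₂ : α → ℤ
  S₁ : Finset α
  S₂ : Finset α

section Augmentation

variable {α : Type*} [DecidableEq α] {M M₁ M₂ : Matroid α} {R₁ R₂ : α → α → Prop}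
  {w w₁ w₂ : α → ℤ} {S S₁ S₂ T : Finset α} {σ τ : Splitting α} {m : ℕ} {v : ℕ → α} {I : Finset ℕ}

/-- The arcs of the weighted exchange graph: `x` leaves the first base for `y`, or enters the
second base for `y`, without a change of weight. -/
def Tight (R₁ R₂ : α → α → Prop) (w₁ w₂ : α → ℤ) (x y : α) : Prop :=
  (R₁ x y ∧ w₁ x = w₁ y) ∨ (R₂ y x ∧ w₂ y = w₂ x)

namespace Splitting

/-- Both bases have maximum weight, so that `σ.S₁ = σ.S₂` is a maximum weight common base for the
weights `σ.w₁ + σ.w₂`. -/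
def Valid (M₁ M₂ : Matroid α) (σ : Splitting α) : Prop :=
  IsMaxBase M₁ σ.w₁ σ.S₁ ∧ IsMaxBase M₂ σ.w₂ σ.S₂

/-- Given the exchange relations `R₁` and `R₂` of the two bases of `σ`, it is certain that `τ` is
another valid splitting of the same weights, with closer bases. -/
def IsAugmentation (R₁ R₂ : α → α → Prop) (σ τ : Splitting α) : Prop :=
  τ.w₁ + τ.w₂ = σ.w₁ + σ.w₂ ∧ (τ.S₁ \ τ.S₂).card < (σ.S₁ \ σ.S₂).card ∧
    ∀ M₁ M₂, σ.Valid M₁ M₂ → IsExchange M₁ σ.S₁ = R₁ → IsExchange M₂ σ.S₂ = R₂ → τ.Valid M₁ M₂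

/-- Exchange along the path `v 0, …, v m`, whose steps `i ∈ I` are exchanges of the first base,
while the other ones are reversed exchanges of the second base. -/
def exchangeAlong (σ : Splitting α) (I : Finset ℕ) (m : ℕ) (v : ℕ → α) : Splitting α where
  w₁ := σ.w₁
  w₂ := σ.w₂
  S₁ := σ.S₁ \ I.image v ∪ I.image fun i => v (i + 1)
  S₂ := σ.S₂ \ (Finset.range m \ I).image (fun i => v (i + 1)) ∪ (Finset.range m \ I).image v

lemma valid_exchangeAlong (hσ : σ.Valid M₁ M₂) (hI : ∀ i ∈ I, i < m)
    (h₁ : ∀ i ∈ I, IsExchange M₁ σ.S₁ (v i) (v (i + 1)) ∧ σ.w₁ (v i) = σ.w₁ (v (i + 1)))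
    (h₂ : ∀ i < m, i ∉ I →
      IsExchange M₂ σ.S₂ (v (i + 1)) (v i) ∧ σ.w₂ (v (i + 1)) = σ.w₂ (v i))
    (hshort : ∀ i j, i + 1 < j → j ≤ m →
      ¬Tight (IsExchange M₁ σ.S₁) (IsExchange M₂ σ.S₂) σ.w₁ σ.w₂ (v i) (v j)) :
    (σ.exchangeAlong I m v).Valid M₁ M₂ := by
  have h₂ : ∀ i ∈ Finset.range m \ I,
      IsExchange M₂ σ.S₂ (v (i + 1)) (v i) ∧ σ.w₂ (v (i + 1)) = σ.w₂ (v i) := fun i hi =>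
    h₂ i (Finset.mem_range.mp (Finset.mem_sdiff.mp hi).1) (Finset.mem_sdiff.mp hi).2
  constructor
  · exact hσ.1.exchange_image_of_tight (g := id) Function.injective_id (fun i hi => (h₁ i hi).1)
      (fun i hi => (h₁ i hi).2) fun i hi j _ hji hw hex =>
        hshort j (i + 1) (Nat.succ_lt_succ hji) (hI i hi) (Or.inl ⟨hex, hw⟩)
  · refine hσ.2.exchange_image_of_tight OrderDual.toDual.injective (fun i hi => (h₂ i hi).1)
      (fun i hi => (h₂ i hi).2) fun i _ j hj hij hw hex =>
        hshort i (j + 1) (Nat.succ_lt_succ hij) ?_ (Or.inr ⟨hex, hw⟩)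
    exact Finset.mem_range.mp (Finset.mem_sdiff.mp hj).1

lemma card_sdiff_exchangeAlong_lt (hI : ∀ i ∈ I, i < m ∧ v i ∈ σ.S₁ ∧ v (i + 1) ∉ σ.S₁)
    (hJ : ∀ i < m, i ∉ I → v (i + 1) ∈ σ.S₂ ∧ v i ∉ σ.S₂) (hinj : Set.InjOn v (Set.Iic m))
    (h0 : v 0 ∈ σ.S₁ \ σ.S₂) (hm : v m ∈ σ.S₂ \ σ.S₁) :
    ((σ.exchangeAlong I m v).S₁ \ (σ.exchangeAlong I m v).S₂).card < (σ.S₁ \ σ.S₂).card := by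
  refine (Finset.card_le_card fun x hx => ?_).trans_lt (Finset.card_erase_lt_of_mem h0)
  simp only [exchangeAlong, Finset.mem_sdiff, Finset.mem_union, Finset.mem_image, Finset.mem_range,
    not_or, not_and, not_not] at hx h0 hm
  obtain ⟨⟨hx₁, hxI⟩ | ⟨i, hi, rfl⟩, hx₂, hxJ⟩ := hx
  · have hxS₂ : x ∉ σ.S₂ := fun hxS₂ => by
      obtain ⟨j, ⟨hj, -⟩, rfl⟩ := hx₂ hxS₂
      obtain hlt | rfl := (Nat.succ_le_of_lt hj).lt_or_eq
      · exact (hJ (j + 1) hlt fun h => hxI ⟨_, h, rfl⟩).2 hxS₂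
      · exact hm.2 hx₁
    rw [Finset.mem_erase, Finset.mem_sdiff]
    refine ⟨?_, hx₁, hxS₂⟩
    rintro rfl
    have hm0 : 0 < m := Nat.pos_of_ne_zero fun h => h0.2 (h ▸ hm.1)
    exact hxJ ⟨0, ⟨hm0, fun h => hxI ⟨0, h, rfl⟩⟩, rfl⟩
  · obtain ⟨him, -, hi₁⟩ := hI i hi
    obtain hlt | rfl := (Nat.succ_le_of_lt him).lt_or_eq
    · exact absurd ⟨i + 1, ⟨hlt, fun h => hi₁ (hI _ h).2.1⟩, rfl⟩ hxJ
    · obtain ⟨j, ⟨hj, hjI⟩, hji⟩ := hx₂ hm.1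
      rw [Nat.succ_injective (hinj (Nat.succ_le_of_lt hj) Set.self_mem_Iic hji)] at hjI
      exact absurd hi hjI

end Splitting

lemma IsMaxBase.add (hS : IsMaxBase M w S) {δ : α → ℤ} (hδ : ∀ a b, δ b ≤ δ a + 1)
    (hdec : ∀ a b, IsExchange M S a b → w a = w b → δ b ≤ δ a) : IsMaxBase M (w + δ) S := by
  refine isMaxBase_iff.2 ⟨hS.1, fun a b hab => ?_⟩
  obtain hlt | heq := (hS.le_of_isExchange hab).lt_or_eq
  · exact (add_le_add_right (hδ a b) _).trans (by rw [Pi.add_apply]; linarith)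
  · exact add_le_add heq.le (hdec a b hab heq.symm)

/-- The dual step: lower the first weight and raise the second one on the set reached from
`S₁ \ S₂`. -/
lemma exists_shift (h₁ : IsMaxBase M₁ w₁ S₁) (h₂ : IsMaxBase M₂ w₂ S₂) (hne : ¬S₁ ⊆ S₂)
    (hpath : ∀ x ∈ S₁ \ S₂, ∀ y ∈ S₂ \ S₁,
      ¬Relation.ReflTransGen (Tight (IsExchange M₁ S₁) (IsExchange M₂ S₂) w₁ w₂) x y) :
    ∃ δ : α → ℤ, IsMaxBase M₁ (w₁ - δ) S₁ ∧ IsMaxBase M₂ (w₂ + δ) S₂ ∧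
      ∑ e ∈ S₂, δ e < ∑ e ∈ S₁, δ e := by
  classical
  set r := Tight (IsExchange M₁ S₁) (IsExchange M₂ S₂) w₁ w₂
  let U : α → Prop := fun y => ∃ x ∈ S₁ \ S₂, Relation.ReflTransGen r x y
  have hU : ∀ x y, U x → r x y → U y := fun x y ⟨z, hz, hzx⟩ hxy => ⟨z, hz, hzx.tail hxy⟩
  refine ⟨fun e => if U e then 1 else 0, ?_, h₂.add (fun a b => ?_) fun a b hab hw => ?_, ?_⟩
  · rw [sub_eq_add_neg]
    refine h₁.add (fun a b => ?_) fun a b hab hw => ?_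
    · simp only [Pi.neg_apply]
      split_ifs <;> norm_num
    · have := fun ha => hU a b ha (Or.inl ⟨hab, hw⟩)
      simp only [Pi.neg_apply]
      split_ifs <;> simp_all
  · split_ifs <;> norm_num
  · have := fun hb => hU b a hb (Or.inr ⟨hab, hw⟩)
    split_ifs <;> simp_all
  · rw [Finset.sum_boole, Finset.sum_boole, Nat.cast_lt]
    obtain ⟨x, hx₁, hx₂⟩ := Finset.not_subset.mp hne
    refine Finset.card_lt_card (Finset.ssubset_iff_of_subset ?_ |>.2 ⟨x, ?_, ?_⟩)
    · intro y hy
      obtain ⟨hy₂, z, hz, hzy⟩ := Finset.mem_filter.mp hy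
      exact Finset.mem_filter.mpr ⟨by_contra fun hy₁ =>
        hpath z hz y (Finset.mem_sdiff.mpr ⟨hy₂, hy₁⟩) hzy, z, hz, hzy⟩
    · exact Finset.mem_filter.mpr ⟨hx₁, x, Finset.mem_sdiff.mpr ⟨hx₁, hx₂⟩, .refl⟩
    · exact fun h => hx₂ (Finset.mem_filter.mp h).1

lemma exists_tight_path (h₁ : IsMaxBase M₁ w₁ S₁) (h₂ : IsMaxBase M₂ w₂ S₂) (hne : ¬S₁ ⊆ S₂)
    (hT₁ : M₁.IsBase T) (hT₂ : M₂.IsBase T) :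
    ∃ u₁ u₂, u₁ + u₂ = w₁ + w₂ ∧ IsMaxBase M₁ u₁ S₁ ∧ IsMaxBase M₂ u₂ S₂ ∧
      ∃ x ∈ S₁ \ S₂, ∃ y ∈ S₂ \ S₁,
        Relation.ReflTransGen (Tight (IsExchange M₁ S₁) (IsExchange M₂ S₂) u₁ u₂) x y := by
  -- The dual objective decreases with every shift, and is at least the weight of `T`.
  induction hn : (∑ e ∈ S₁, w₁ e + ∑ e ∈ S₂, w₂ e - ∑ e ∈ T, (w₁ + w₂) e).toNat
    using Nat.strong_induction_on generalizing w₁ w₂ with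
  | _ n ih =>
  by_cases hpath : ∃ x ∈ S₁ \ S₂, ∃ y ∈ S₂ \ S₁,
      Relation.ReflTransGen (Tight (IsExchange M₁ S₁) (IsExchange M₂ S₂) w₁ w₂) x y
  · exact ⟨w₁, w₂, rfl, h₁, h₂, hpath⟩
  push Not at hpath
  obtain ⟨δ, hδ₁, hδ₂, hδ⟩ := exists_shift h₁ h₂ hne hpath
  have hsum : w₁ - δ + (w₂ + δ) = w₁ + w₂ := by ring
  have hlt : (∑ e ∈ S₁, (w₁ - δ) e + ∑ e ∈ S₂, (w₂ + δ) e
      - ∑ e ∈ T, (w₁ - δ + (w₂ + δ)) e).toNat < n := by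
    have hT := add_le_add (hδ₁.2 T hT₁) (hδ₂.2 T hT₂)
    rw [← Finset.sum_add_distrib] at hT
    simp only [← Pi.add_apply (w₁ - δ), hsum] at hT
    rw [← hn, hsum]
    simp only [Pi.sub_apply, Pi.add_apply, Finset.sum_sub_distrib, Finset.sum_add_distrib] at hT ⊢
    omega
  obtain ⟨u₁, u₂, hu, h⟩ := ih _ hlt hδ₁ hδ₂ rfl
  exact ⟨u₁, u₂, hu.trans hsum, h⟩

lemma Splitting.Valid.exists_isAugmentation (hσ : σ.Valid M₁ M₂) (hne : ¬σ.S₁ ⊆ σ.S₂)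
    (hT₁ : M₁.IsBase T) (hT₂ : M₂.IsBase T) :
    ∃ τ, IsAugmentation (IsExchange M₁ σ.S₁) (IsExchange M₂ σ.S₂) σ τ := by
  classical
  obtain ⟨u₁, u₂, hu, hu₁, hu₂, x, hx, y, hy, hxy⟩ := exists_tight_path hσ.1 hσ.2 hne hT₁ hT₂
  obtain ⟨m, v, ⟨rfl, rfl, hv⟩, hinj, hshort⟩ := exists_isPath_injOn_chordless hxy
  set I := {i ∈ Finset.range m |
    IsExchange M₁ σ.S₁ (v i) (v (i + 1)) ∧ u₁ (v i) = u₁ (v (i + 1))} with hI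
  have h₁ : ∀ i ∈ I, i < m ∧ IsExchange M₁ σ.S₁ (v i) (v (i + 1)) ∧ u₁ (v i) = u₁ (v (i + 1)) :=
    fun i hi => by simpa only [hI, Finset.mem_filter, Finset.mem_range] using hi
  have h₂ : ∀ i < m, i ∉ I → IsExchange M₂ σ.S₂ (v (i + 1)) (v i) ∧ u₂ (v (i + 1)) = u₂ (v i) :=
    fun i hi hiI => (hv i hi).resolve_left fun h =>
      hiI (Finset.mem_filter.mpr ⟨Finset.mem_range.mpr hi, h⟩)
  refine ⟨exchangeAlong ⟨u₁, u₂, σ.S₁, σ.S₂⟩ I m v, hu, ?_, fun N₁ N₂ hN hR₁ hR₂ => ?_⟩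
  · exact card_sdiff_exchangeAlong_lt (σ := ⟨u₁, u₂, σ.S₁, σ.S₂⟩)
      (fun i hi => ⟨(h₁ i hi).1, (h₁ i hi).2.1.1, (h₁ i hi).2.1.2.1⟩)
      (fun i hi hiI => ⟨(h₂ i hi hiI).1.1, (h₂ i hi hiI).1.2.1⟩) hinj hx hy
  · have hN' : Valid N₁ N₂ ⟨u₁, u₂, σ.S₁, σ.S₂⟩ :=
      ⟨isMaxBase_iff.2 ⟨hN.1.1, hR₁ ▸ (isMaxBase_iff.1 hu₁).2⟩,
        isMaxBase_iff.2 ⟨hN.2.1, hR₂ ▸ (isMaxBase_iff.1 hu₂).2⟩⟩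
    rw [← hR₁, ← hR₂] at hshort
    rw [← hR₁] at h₁
    rw [← hR₂] at h₂
    exact valid_exchangeAlong hN' (fun i hi => (h₁ i hi).1) (fun i hi => (h₁ i hi).2) h₂ hshort

end Augmentation

section Greedy

variable {α : Type*} [Fintype α] {M : Matroid α} {w w' : α → ℤ} {e f : α}

/-- Greedy processing order: by decreasing weight, ties being broken by a fixed enumeration. -/
noncomputable def greedyKey (w : α → ℤ) (e : α) : ℤ ×ₗ Fin (Fintype.card α) :=
  toLex (-w e, Fintype.equivFin α e)

lemma greedyKey_injective (w : α → ℤ) : Function.Injective (greedyKey w) := fun _ _ h =>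
  (Fintype.equivFin α).injective (Prod.ext_iff.1 (toLex.injective h)).2

/-- The elements that the greedy algorithm processes before `e`. -/
noncomputable def earlier (w : α → ℤ) (e : α) : Finset α :=
  {f | greedyKey w f < greedyKey w e}

lemma mem_earlier : f ∈ earlier w e ↔ greedyKey w f < greedyKey w e := by
  simp only [earlier, Finset.mem_filter_univ]

lemma earlier_subset_earlier (he : w' e = w e) (hle : w' ≤ w) : earlier w' e ⊆ earlier w e := by
  intro f hf
  simp only [mem_earlier, greedyKey, Prod.Lex.toLex_lt_toLex, he] at hf ⊢
  have := hle f
  lia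

open Classical in
/-- The base found by the greedy algorithm: the elements that are not spanned by those processed
before. -/
noncomputable def greedyBase (M : Matroid α) (w : α → ℤ) : Finset α :=
  {e | e ∈ M.E \ M.closure (earlier w e)}

lemma mem_greedyBase : e ∈ greedyBase M w ↔ e ∈ M.E \ M.closure (earlier w e) := by
  simp only [greedyBase, Finset.mem_filter_univ]

lemma mem_greedyBase_of_le (he : w' e = w e) (hle : w' ≤ w) (h : e ∈ greedyBase M w) :
    e ∈ greedyBase M w' := by
  rw [mem_greedyBase] at h ⊢
  exact ⟨h.1, fun h' => h.2 (M.closure_subset_closure (earlier_subset_earlier he hle) h')⟩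

lemma mem_closure_greedyBase (w : α → ℤ) (he : e ∈ M.E) :
    e ∈ M.closure {f ∈ greedyBase M w | greedyKey w f ≤ greedyKey w e} := by
  induction hn : (earlier w e).card using Nat.strong_induction_on generalizing e with
  | _ n ih =>
  by_cases hmem : e ∈ greedyBase M w
  · exact M.mem_closure_of_mem' ⟨hmem, le_rfl⟩
  have hspan : e ∈ M.closure (earlier w e ∩ M.E) := by
    rw [mem_greedyBase] at hmem
    rw [M.closure_inter_ground]
    exact by_contra fun h => hmem ⟨he, h⟩
  refine M.closure_subset_closure_of_subset_closure (fun f hf => ?_) hspan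
  have hfe : greedyKey w f < greedyKey w e := mem_earlier.1 hf.1
  have hlt : (earlier w f).card < n := hn ▸ Finset.card_lt_card
    (Finset.ssubset_iff_of_subset (fun g hg => mem_earlier.2 ((mem_earlier.1 hg).trans hfe)) |>.2
      ⟨f, hf.1, fun h => (mem_earlier.1 h).false⟩)
  refine M.closure_subset_closure ?_ (ih _ hlt hf.2 rfl)
  exact fun g hg => ⟨hg.1, hg.2.trans hfe.le⟩

lemma isBase_greedyBase (M : Matroid α) (w : α → ℤ) : M.IsBase (greedyBase M w) := by
  have hE : (greedyBase M w : Set α) ⊆ M.E := fun e he => (mem_greedyBase.1 he).1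
  rw [Matroid.isBase_iff_indep_closure_eq]
  refine ⟨by_contra fun hdep => ?_, (M.closure_subset_ground _).antisymm fun e he =>
    M.closure_subset_closure (fun f hf => hf.1) (mem_closure_greedyBase w he)⟩
  obtain ⟨C, hCs, hC⟩ := ((M.not_indep_iff hE).1 hdep).exists_isCircuit_subset
  obtain ⟨e, heC, hmax⟩ := Set.exists_max_image C (greedyKey w) C.toFinite hC.nonempty
  refine (mem_greedyBase.1 (hCs heC)).2
    (M.closure_subset_closure (fun f hf => ?_) (hC.mem_closure_sdiff_singleton_of_mem heC))
  exact mem_earlier.2 ((hmax f hf.1).lt_of_ne fun h => hf.2 (greedyKey_injective w h))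

lemma isMaxBase_greedyBase (M : Matroid α) (w : α → ℤ) :
    IsMaxBase M w (greedyBase M w) := by
  classical
  have hB := isBase_greedyBase M w
  refine isMaxBase_iff.2 ⟨hB, fun a b hab => le_of_not_gt fun hlt => ?_⟩
  have hb := ((isExchange_iff hB).1 hab).2.2
  refine hb.2 (M.closure_subset_closure ?_ (mem_closure_greedyBase w hb.1))
  refine fun f hf => ⟨hf.1, ?_⟩
  rintro rfl
  exact hf.2.not_gt (Prod.Lex.toLex_lt_toLex.2 (Or.inl (neg_lt_neg hlt)))

/-- The splitting into two weight functions, together with greedy bases. -/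
noncomputable def greedySplitting (M₁ M₂ : Matroid α) (w₁ w₂ : α → ℤ) : Splitting α :=
  ⟨w₁, w₂, greedyBase M₁ w₁, greedyBase M₂ w₂⟩

lemma valid_greedySplitting (M₁ M₂ : Matroid α) (w₁ w₂ : α → ℤ) :
    (greedySplitting M₁ M₂ w₁ w₂).Valid M₁ M₂ :=
  ⟨isMaxBase_greedyBase M₁ w₁, isMaxBase_greedyBase M₂ w₂⟩

end Greedy

section AuctionWeights

variable {α : Type*} {w u : α → ℤ} {δ : ℤ} {p q : α → ℕ}

/-- The first weight function of the auction, after the element `e` has been raised `p e` times: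
the odd raises of an element increase its second weight, the even ones decrease its first weight. -/
def auctionWeight₁ (u : α → ℤ) (δ : ℤ) (p : α → ℕ) (e : α) : ℤ := u e - δ * (p e / 2 : ℕ)

/-- The second weight function of the auction, after the element `e` has been raised `p e` times. -/
def auctionWeight₂ (w u : α → ℤ) (δ : ℤ) (p : α → ℕ) (e : α) : ℤ :=
  w e - u e + δ * ((p e + 1) / 2 : ℕ)

lemma auctionWeight₁_antitone (hδ : 0 ≤ δ) (hpq : p ≤ q) :
    auctionWeight₁ u δ q ≤ auctionWeight₁ u δ p := fun e =>
  sub_le_sub_left (mul_le_mul_of_nonneg_left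
    (Nat.cast_le.2 (Nat.div_le_div_right (hpq e))) hδ) _

lemma auctionWeight₂_monotone (hδ : 0 ≤ δ) (hpq : p ≤ q) :
    auctionWeight₂ w u δ p ≤ auctionWeight₂ w u δ q := fun e =>
  add_le_add_right (mul_le_mul_of_nonneg_left
    (Nat.cast_le.2 (Nat.div_le_div_right (Nat.succ_le_succ (hpq e)))) hδ) _

end AuctionWeights

/-- How an algorithm accesses a matroid on `α`: it can find greedy bases, and the exchanges that
are possible in a given base. -/
structure Access (Q A α : Type) where
  base : (α → ℤ) → ParallelAlg Q A (Finset α)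
  exchanges : Finset α → ParallelAlg Q A (α → α → Prop)

section Algorithm

variable {Q A α : Type} [Fintype α] [DecidableEq α] {M M₁ M₂ : Matroid α} {acc₁ acc₂ : Access Q A α}
  {o : Q → A} {t : ℝ} {c k d X Y : ℕ} {w u v : α → ℤ} {S T : Finset α} {σ : Splitting α} {δ : ℤ}
  {p q : α → ℕ}

/-- The access is correct for `M`: greedy bases are found in `t` rounds and exchanges in a single
one, by at most `c` queries per round. -/
structure Access.Correct (acc : Access Q A α) (o : Q → A) (M : Matroid α) (t : ℝ) (c : ℕ) :
    Prop where
  base : ∀ w, (acc.base w).Spec o t c (· = greedyBase M w)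
  exchanges : ∀ S : Finset α, M.IsBase S → (acc.exchanges S).Spec o 1 c (· = IsExchange M S)

open Classical in
/-- Perform an augmentation if there is one. -/
noncomputable def augment (acc₁ acc₂ : Access Q A α) (σ : Splitting α) :
    ParallelAlg Q A (Splitting α) :=
  ((acc₁.exchanges σ.S₁).par (acc₂.exchanges σ.S₂)).map fun R =>
    if h : ∃ τ, σ.IsAugmentation R.1 R.2 τ then h.choose else σ

/-- The progress made by `y` augmentations that start from `σ`. -/
structure Splitting.IsCloser (M₁ M₂ : Matroid α) (σ : Splitting α) (y : ℕ) (τ : Splitting α) :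
    Prop where
  valid : τ.Valid M₁ M₂
  add_eq : τ.w₁ + τ.w₂ = σ.w₁ + σ.w₂
  card_le : (τ.S₁ \ τ.S₂).card ≤ (σ.S₁ \ σ.S₂).card - y

lemma augment_spec (h₁ : acc₁.Correct o M₁ t c) (h₂ : acc₂.Correct o M₂ t c)
    (hT₁ : M₁.IsBase T) (hT₂ : M₂.IsBase T) (hσ : σ.Valid M₁ M₂) :
    (augment acc₁ acc₂ σ).Spec o 1 (c + c) (σ.IsCloser M₁ M₂ 1) := by
  refine ((h₁.exchanges _ hσ.1.1).par (h₂.exchanges _ hσ.2.1)).map ?_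
  rintro ⟨_, _⟩ ⟨rfl, rfl⟩
  split_ifs with hex
  · obtain ⟨hadd, hlt, hvalid⟩ := hex.choose_spec
    exact ⟨hvalid M₁ M₂ hσ rfl rfl, hadd, Nat.le_sub_one_of_lt hlt⟩
  · have hsub : σ.S₁ ⊆ σ.S₂ := by_contra fun hne => hex (hσ.exists_isAugmentation hne hT₁ hT₂)
    refine ⟨hσ, rfl, ?_⟩
    rw [Finset.sdiff_eq_empty_iff_subset.2 hsub, Finset.card_empty]

lemma iter_augment_spec (h₁ : acc₁.Correct o M₁ t c) (h₂ : acc₂.Correct o M₂ t c)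
    (hT₁ : M₁.IsBase T) (hT₂ : M₂.IsBase T) (hσ : σ.Valid M₁ M₂) (Y : ℕ) :
    (ParallelAlg.iter (augment acc₁ acc₂) Y σ).Spec o Y (c + c) (σ.IsCloser M₁ M₂ Y) := by
  have hstep : ∀ i τ, σ.IsCloser M₁ M₂ i τ →
      (augment acc₁ acc₂ τ).Spec o 1 (c + c) (σ.IsCloser M₁ M₂ (i + 1)) := fun i τ hτ =>
    (augment_spec h₁ h₂ hT₁ hT₂ hτ.valid).mono le_rfl le_rfl fun ρ hρ =>
      ⟨hρ.valid, hρ.add_eq.trans hτ.add_eq, hρ.card_le.trans (Nat.sub_le_sub_right hτ.card_le 1)⟩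
  exact (ParallelAlg.Spec.iter hstep Y ⟨hσ, rfl, le_rfl⟩).mono (mul_one _).le le_rfl fun _ => id

/-- The algorithm that finds the greedy splitting. -/
def findSplitting (acc₁ acc₂ : Access Q A α) (w₁ w₂ : α → ℤ) : ParallelAlg Q A (Splitting α) :=
  ((acc₁.base w₁).par (acc₂.base w₂)).map fun B => ⟨w₁, w₂, B.1, B.2⟩

lemma findSplitting_spec (h₁ : acc₁.Correct o M₁ t c) (h₂ : acc₂.Correct o M₂ t c)
    (w₁ w₂ : α → ℤ) :
    (findSplitting acc₁ acc₂ w₁ w₂).Spec o t (c + c) (· = greedySplitting M₁ M₂ w₁ w₂) := by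
  refine ((h₁.base w₁).par (h₂.base w₂)).map ?_
  rintro ⟨B₁, B₂⟩ ⟨rfl, rfl⟩
  rfl

/-- The greedy splitting for the weights of the auction. -/
noncomputable def auctionSplitting (M₁ M₂ : Matroid α) (w u : α → ℤ) (δ : ℤ) (p : α → ℕ) :
    Splitting α :=
  greedySplitting M₁ M₂ (auctionWeight₁ u δ p) (auctionWeight₂ w u δ p)

/-- The elements that are only in the first base and have been raised less than `2 * d` times. -/
def contested (d : ℕ) (σ : Splitting α) (p : α → ℕ) : Finset α :=
  {e ∈ σ.S₁ \ σ.S₂ | p e < 2 * d}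

/-- Raise all the contested elements, if there are more than `k / d` of them. -/
def raise (k d : ℕ) (σ : Splitting α) (p : α → ℕ) : α → ℕ :=
  if k < (contested d σ p).card * d then fun e => p e + if e ∈ contested d σ p then 1 else 0
  else p

/-- One round of the auction. -/
def auction (acc₁ acc₂ : Access Q A α) (k d : ℕ) (w u : α → ℤ) (δ : ℤ) (p : α → ℕ) :
    ParallelAlg Q A (α → ℕ) :=
  (findSplitting acc₁ acc₂ (auctionWeight₁ u δ p) (auctionWeight₂ w u δ p)).map fun σ =>
    raise k d σ p

/-- The invariant of the auction: an element that has been raised and is in the second base is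
also in the first one. -/
structure AuctionInv (M₁ M₂ : Matroid α) (d : ℕ) (w u : α → ℤ) (δ : ℤ) (p : α → ℕ) : Prop where
  le : ∀ e, p e ≤ 2 * d
  mem : ∀ e, p e ≠ 0 → e ∈ (auctionSplitting M₁ M₂ w u δ p).S₂ →
    e ∈ (auctionSplitting M₁ M₂ w u δ p).S₁

lemma AuctionInv.raise (hδ : 0 ≤ δ) (hp : AuctionInv M₁ M₂ d w u δ p) :
    AuctionInv M₁ M₂ d w u δ (raise k d (auctionSplitting M₁ M₂ w u δ p) p) := by
  rw [MatroidIntersection.raise]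
  split_ifs with hk
  swap
  · exact hp
  set σ := auctionSplitting M₁ M₂ w u δ p
  set q : α → ℕ := fun e => p e + if e ∈ contested d σ p then 1 else 0 with hq
  have hpq : p ≤ q := fun e => Nat.le_add_right _ _
  have hstay₁ : ∀ e, q e / 2 = p e / 2 → e ∈ σ.S₁ → e ∈ (auctionSplitting M₁ M₂ w u δ q).S₁ :=
    fun e he => mem_greedyBase_of_le (by simp only [auctionWeight₁, he])
      (auctionWeight₁_antitone hδ hpq)
  have hstay₂ : ∀ e, (q e + 1) / 2 = (p e + 1) / 2 →
      e ∈ (auctionSplitting M₁ M₂ w u δ q).S₂ → e ∈ σ.S₂ :=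
    fun e he => mem_greedyBase_of_le (by simp only [auctionWeight₂, he])
      (auctionWeight₂_monotone hδ hpq)
  suffices ∀ e, q e ≤ 2 * d ∧ (q e ≠ 0 → e ∈ (auctionSplitting M₁ M₂ w u δ q).S₂ →
      e ∈ (auctionSplitting M₁ M₂ w u δ q).S₁) from ⟨fun e => (this e).1, fun e => (this e).2⟩
  intro e
  by_cases he : e ∈ contested d σ p
  · have hqe : q e = p e + 1 := by simp only [hq, if_pos he]
    simp only [contested, Finset.mem_filter, Finset.mem_sdiff] at he
    refine ⟨by lia, fun _ he₂ => ?_⟩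
    obtain ⟨j, hj | hj⟩ := Nat.even_or_odd' (p e)
    · exact hstay₁ e (by lia) he.1.1
    · exact absurd (hstay₂ e (by lia) he₂) he.1.2
  · have hqe : q e = p e := by simp only [hq, if_neg he, add_zero]
    exact ⟨hqe ▸ hp.le e, fun h0 he₂ => hstay₁ e (by rw [hqe])
      (hp.mem e (hqe ▸ h0) (hstay₂ e (by rw [hqe]) he₂))⟩

lemma sum_raise (hk : k < (contested d σ p).card * d) :
    ∑ e, raise k d σ p e = ∑ e, p e + (contested d σ p).card := by
  simp only [raise, if_pos hk, Finset.sum_add_distrib, Finset.sum_boole, Finset.filter_univ_mem,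
    Nat.cast_id]

lemma iter_auction_spec (h₁ : acc₁.Correct o M₁ t c) (h₂ : acc₂.Correct o M₂ t c) (hδ : 0 ≤ δ)
    (k d : ℕ) (w u : α → ℤ) (X : ℕ) :
    (ParallelAlg.iter (auction acc₁ acc₂ k d w u δ) X 0).Spec o (X * t) (c + c) fun p =>
      AuctionInv M₁ M₂ d w u δ p ∧
        ((contested d (auctionSplitting M₁ M₂ w u δ p) p).card * d ≤ k ∨
          X * k ≤ d * ∑ e, p e) := by
  refine ParallelAlg.Spec.iter (I := fun i p => AuctionInv M₁ M₂ d w u δ p ∧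
    ((contested d (auctionSplitting M₁ M₂ w u δ p) p).card * d ≤ k ∨ i * k ≤ d * ∑ e, p e))
    (fun i p hp => ?_) X ⟨⟨fun _ => Nat.zero_le _, fun e h => absurd rfl h⟩, Or.inr (by simp)⟩
  refine (findSplitting_spec h₁ h₂ _ _).map ?_
  rintro _ rfl
  change AuctionInv M₁ M₂ d w u δ (raise k d (auctionSplitting M₁ M₂ w u δ p) p) ∧ _
  refine ⟨hp.1.raise hδ, ?_⟩
  by_cases hk : k < (contested d (auctionSplitting M₁ M₂ w u δ p) p).card * d
  · right
    rw [← auctionSplitting, sum_raise hk, mul_add, Nat.succ_mul, mul_comm d (Finset.card _)]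
    exact add_le_add (hp.2.resolve_left hk.not_ge) hk.le
  · left
    rw [← auctionSplitting, show raise k d (auctionSplitting M₁ M₂ w u δ p) p = p from if_neg hk]
    exact not_lt.1 hk

lemma AuctionInv.sum_sdiff_le (hp : AuctionInv M₁ M₂ d w u δ p) (hk₁ : M₁.eRank = k)
    (hk₂ : M₂.eRank = k) (hδ : 0 < δ) (hu : IsMaxBase M₁ u S) (hv : IsMaxBase M₂ v S)
    (huv : ∀ e, |u e + v e - w e| ≤ 2 * δ) :
    ∑ e ∈ (auctionSplitting M₁ M₂ w u δ p).S₁ \ (auctionSplitting M₁ M₂ w u δ p).S₂,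
      ((p e / 2 : ℕ) : ℤ) ≤ 5 * k := by
  obtain ⟨hG₁, hG₂⟩ := valid_greedySplitting M₁ M₂ (auctionWeight₁ u δ p) (auctionWeight₂ w u δ p)
  have hmem := hp.mem
  rw [auctionSplitting] at hmem ⊢
  set σ := greedySplitting M₁ M₂ (auctionWeight₁ u δ p) (auctionWeight₂ w u δ p)
  set h : α → ℤ := fun e => ((p e / 2 : ℕ) : ℤ) with hh
  set g : α → ℤ := fun e => (((p e + 1) / 2 : ℕ) : ℤ) with hg
  have hS₁ : ∑ e ∈ σ.S₁, h e ≤ ∑ e ∈ S, h e + 2 * 0 * k :=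
    hG₁.sum_le_sum_add hu hk₁ hδ fun e => by simp [σ, greedySplitting, auctionWeight₁, hh]
  have hS : ∑ e ∈ S, h e ≤ ∑ e ∈ S, g e := Finset.sum_le_sum fun e _ => by simp only [hh, hg]; lia
  have hS₂ : ∑ e ∈ S, g e ≤ ∑ e ∈ σ.S₂, g e + 2 * 2 * k :=
    hv.sum_le_sum_add hG₂ hk₂ hδ fun e => by
      rw [← abs_neg]
      convert huv e using 2
      simp only [σ, greedySplitting, auctionWeight₂, hg]
      ring
  have hgh : ∑ e ∈ σ.S₂, g e ≤ ∑ e ∈ σ.S₂, h e + k := by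
    refine (Finset.sum_le_sum fun e _ => show g e ≤ h e + 1 by simp only [hh, hg]; lia).trans ?_
    rw [Finset.sum_add_distrib, Finset.sum_const, nsmul_one, card_eq_of_isBase hG₂.1 hk₂]
  have hzero : ∑ e ∈ σ.S₂ \ σ.S₁, h e = 0 := Finset.sum_eq_zero fun e he => by
    rw [Finset.mem_sdiff] at he
    simp only [hh, show p e = 0 from by_contra fun hne => he.2 (hmem e hne he.1),
      Nat.zero_div, Nat.cast_zero]
  have hinter₁ := Finset.sum_inter_add_sum_sdiff σ.S₁ σ.S₂ h
  have hinter₂ := Finset.sum_inter_add_sum_sdiff σ.S₂ σ.S₁ h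
  rw [Finset.inter_comm] at hinter₂
  linarith

/-- When few elements are contested, the two greedy bases of the auction are close. -/
lemma AuctionInv.card_sdiff_le (hp : AuctionInv M₁ M₂ d w u δ p) (hk₁ : M₁.eRank = k)
    (hk₂ : M₂.eRank = k) (hδ : 0 < δ) (hu : IsMaxBase M₁ u S) (hv : IsMaxBase M₂ v S)
    (huv : ∀ e, |u e + v e - w e| ≤ 2 * δ)
    (hfew : (contested d (auctionSplitting M₁ M₂ w u δ p) p).card * d ≤ k) :
    ((auctionSplitting M₁ M₂ w u δ p).S₁ \ (auctionSplitting M₁ M₂ w u δ p).S₂).card * d ≤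
      6 * k := by
  have hsum := hp.sum_sdiff_le hk₁ hk₂ hδ hu hv huv
  rw [contested] at hfew
  set D := (auctionSplitting M₁ M₂ w u δ p).S₁ \ (auctionSplitting M₁ M₂ w u δ p).S₂
  have hmany : ({e ∈ D | ¬p e < 2 * d}.card * d : ℤ) ≤ 5 * k := by
    refine le_trans ?_ (hsum.trans' (Finset.sum_le_sum_of_subset_of_nonneg
      (Finset.filter_subset (fun e => ¬p e < 2 * d) D) fun e _ _ => Nat.cast_nonneg _))
    rw [← nsmul_eq_mul]
    exact Finset.card_nsmul_le_sum _ _ _ fun e he => by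
      have := (Finset.mem_filter.1 he).2
      lia
  rw [← Finset.card_filter_add_card_filter_not fun e => p e < 2 * d, add_mul]
  have hmany : {e ∈ D | ¬p e < 2 * d}.card * d ≤ 5 * k := by exact_mod_cast hmany
  linarith

end Algorithm

section Scaling

variable {Q A α : Type} {M₁ M₂ : Matroid α} {acc₁ acc₂ : Access Q A α}
  {o : Q → A} {t : ℝ} {c k d X Y L : ℕ} {w : α → ℤ} {S D : Finset α} {σ : Splitting α} {δ : ℤ}

lemma auctionWeight_add (w u : α → ℤ) (δ : ℤ) (p : α → ℕ) (e : α) :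
    auctionWeight₁ u δ p e + auctionWeight₂ w u δ p e = w e ∨
      auctionWeight₁ u δ p e + auctionWeight₂ w u δ p e = w e + δ := by
  have : (p e + 1) / 2 = p e / 2 ∨ (p e + 1) / 2 = p e / 2 + 1 := by lia
  refine this.imp (fun h => ?_) fun h => ?_ <;> simp only [auctionWeight₁, auctionWeight₂, h]
  · ring
  · push_cast
    ring

/-- A common base that is optimal for a splitting of a weight function close to `w`. -/
structure Splitting.Close (M₁ M₂ : Matroid α) (w : α → ℤ) (δ : ℤ) (σ : Splitting α) : Prop where
  valid : σ.Valid M₁ M₂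
  eq : σ.S₁ = σ.S₂
  le : ∀ e, |σ.w₁ e + σ.w₂ e - w e| ≤ δ

/-- `S` is a common base of maximum weight. -/
def IsMaxCommonBase (M₁ M₂ : Matroid α) (w : α → ℤ) (S : Finset α) : Prop :=
  M₁.IsBase S ∧ M₂.IsBase S ∧
    ∀ T : Finset α, M₁.IsBase T → M₂.IsBase T → ∑ e ∈ T, w e ≤ ∑ e ∈ S, w e

/-- After multiplying the weights by `k + 1`, an error of `1` on each of the `k` elements of a base
does not matter. -/
lemma Splitting.Close.isMaxCommonBase (hσ : σ.Close M₁ M₂ (fun e => (k + 1) * w e) 1)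
    (hle : ∀ e, (k + 1) * w e ≤ σ.w₁ e + σ.w₂ e) (hk : M₁.eRank = k) :
    IsMaxCommonBase M₁ M₂ w σ.S₁ := by
  have h₂ : IsMaxBase M₂ σ.w₂ σ.S₁ := hσ.eq ▸ hσ.valid.2
  refine ⟨hσ.valid.1.1, h₂.1, fun T hT₁ hT₂ => ?_⟩
  have hT := Finset.sum_le_sum fun e (_ : e ∈ T) => hle e
  have hS : ∑ e ∈ σ.S₁, (σ.w₁ e + σ.w₂ e) ≤ ∑ e ∈ σ.S₁, ((k + 1) * w e + 1) :=
    Finset.sum_le_sum fun e _ => by linarith [(abs_le.1 (hσ.le e)).2]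
  simp only [Finset.sum_add_distrib, Finset.sum_const, nsmul_one, ← Finset.mul_sum,
    card_eq_of_isBase hσ.valid.1.1 hk] at hT hS
  have : ((k : ℤ) + 1) * (∑ e ∈ T, w e) < (k + 1) * (∑ e ∈ σ.S₁, w e + 1) := by
    linarith [hσ.valid.1.2 T hT₁, h₂.2 T hT₂]
  exact Int.lt_add_one_iff.1 (lt_of_mul_lt_mul_left this (by positivity))

variable [Fintype α] [DecidableEq α]

/-- One scaling phase: `X` rounds of auction followed by `Y` augmentations. -/
noncomputable def phase (acc₁ acc₂ : Access Q A α) (k d X Y : ℕ) (w : α → ℤ) (δ : ℤ)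
    (σ : Splitting α) : ParallelAlg Q A (Splitting α) :=
  (ParallelAlg.iter (auction acc₁ acc₂ k d w σ.w₁ δ) X 0).bind fun p =>
    (findSplitting acc₁ acc₂ (auctionWeight₁ σ.w₁ δ p) (auctionWeight₂ w σ.w₁ δ p)).bind
      (ParallelAlg.iter (augment acc₁ acc₂) Y)

/-- Numbers of rounds that suffice for a scaling phase on `n` elements in rank `k`: either there
are enough augmentations without the auction, or the `X` rounds of auction are more than the prices
allow, and leave at most `6 * k / d ≤ Y` augmentations. -/
def PhaseParams (n k d X Y : ℕ) : Prop := k ≤ Y ∨ 2 * d ^ 2 * n < X * k ∧ 0 < d ∧ 6 * k ≤ Y * d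

lemma card_sdiff_auctionSplitting_le (hk₁ : M₁.eRank = k) (hk₂ : M₂.eRank = k) (hδ : 0 < δ)
    (hXY : PhaseParams (Fintype.card α) k d X Y) (hσ : σ.Close M₁ M₂ w (2 * δ)) {p : α → ℕ}
    (hp : AuctionInv M₁ M₂ d w σ.w₁ δ p)
    (hend : (contested d (auctionSplitting M₁ M₂ w σ.w₁ δ p) p).card * d ≤ k ∨
      X * k ≤ d * ∑ e, p e) :
    ((auctionSplitting M₁ M₂ w σ.w₁ δ p).S₁ \ (auctionSplitting M₁ M₂ w σ.w₁ δ p).S₂).card ≤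
      Y := by
  obtain hY | ⟨hX, hd, hY⟩ := hXY
  · exact (Finset.card_le_card Finset.sdiff_subset).trans
      ((card_eq_of_isBase (isBase_greedyBase M₁ _) hk₁).trans_le hY)
  have hsum : d * ∑ e, p e ≤ 2 * d ^ 2 * Fintype.card α := by
    have := Finset.sum_le_card_nsmul Finset.univ p _ fun e _ => hp.le e
    rw [Finset.card_univ, smul_eq_mul] at this
    nlinarith
  exact le_of_mul_le_mul_right ((hp.card_sdiff_le hk₁ hk₂ hδ hσ.valid.1 (hσ.eq ▸ hσ.valid.2) hσ.le
    (hend.resolve_right (hsum.trans_lt hX).not_ge)).trans hY) hd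

lemma phase_spec (h₁ : acc₁.Correct o M₁ t c) (h₂ : acc₂.Correct o M₂ t c) (hk₁ : M₁.eRank = k)
    (hk₂ : M₂.eRank = k) (hδ : 0 < δ) (hXY : PhaseParams (Fintype.card α) k d X Y)
    (hσ : σ.Close M₁ M₂ w (2 * δ)) :
    (phase acc₁ acc₂ k d X Y w δ σ).Spec o (X * t + (t + Y)) (c + c)
      fun τ => τ.Close M₁ M₂ w δ ∧ w ≤ τ.w₁ + τ.w₂ := by
  refine (iter_auction_spec h₁ h₂ hδ.le k d w σ.w₁ X).bind fun p ⟨hp, hend⟩ =>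
    (findSplitting_spec h₁ h₂ _ _).bind ?_
  rintro _ rfl
  have hvalid := valid_greedySplitting M₁ M₂ (auctionWeight₁ σ.w₁ δ p) (auctionWeight₂ w σ.w₁ δ p)
  refine (iter_augment_spec h₁ h₂ hσ.valid.1.1 (hσ.eq ▸ hσ.valid.2.1) hvalid Y).mono le_rfl le_rfl
    fun τ hτ => ?_
  have hsub : τ.S₁ ⊆ τ.S₂ := by
    rw [← Finset.sdiff_eq_empty_iff_subset, ← Finset.card_eq_zero, ← Nat.le_zero]
    refine hτ.card_le.trans (Nat.sub_eq_zero_of_le ?_).le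
    exact card_sdiff_auctionSplitting_le hk₁ hk₂ hδ hXY hσ hp hend
  have heq : τ.S₁ = τ.S₂ := Finset.eq_of_subset_of_card_le hsub <| by
    rw [card_eq_of_isBase hτ.valid.1.1 hk₁, card_eq_of_isBase hτ.valid.2.1 hk₂]
  have hadd : ∀ e, τ.w₁ e + τ.w₂ e = w e ∨ τ.w₁ e + τ.w₂ e = w e + δ := fun e => by
    rw [← Pi.add_apply, hτ.add_eq]
    exact auctionWeight_add w σ.w₁ δ p e
  refine ⟨⟨hτ.valid, heq, fun e => ?_⟩, fun e => ?_⟩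
  · obtain h | h := hadd e
    · simpa only [h, sub_self, abs_zero] using hδ.le
    · simp only [h, add_sub_cancel_left, abs_of_pos hδ, le_rfl]
  · obtain h | h := hadd e
    · exact h.ge
    · exact h.ge.trans' (le_add_of_nonneg_right hδ.le)

/-- Phases with precisions `2 ^ L, …, 2, 1`. -/
noncomputable def scaling (acc₁ acc₂ : Access Q A α) (k d X Y : ℕ) (w : α → ℤ) :
    ℕ → Splitting α → ParallelAlg Q A (Splitting α)
  | 0, σ => phase acc₁ acc₂ k d X Y w 1 σ
  | L + 1, σ => (phase acc₁ acc₂ k d X Y w (2 ^ (L + 1)) σ).bind (scaling acc₁ acc₂ k d X Y w L)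

lemma scaling_spec (h₁ : acc₁.Correct o M₁ t c) (h₂ : acc₂.Correct o M₂ t c) (hk₁ : M₁.eRank = k)
    (hk₂ : M₂.eRank = k) (hXY : PhaseParams (Fintype.card α) k d X Y) (L : ℕ)
    (hσ : σ.Close M₁ M₂ w (2 * 2 ^ L)) :
    (scaling acc₁ acc₂ k d X Y w L σ).Spec o ((L + 1) * (X * t + (t + Y))) (c + c)
      fun τ => τ.Close M₁ M₂ w 1 ∧ w ≤ τ.w₁ + τ.w₂ := by
  induction L generalizing σ with
  | zero =>
    rw [Nat.cast_zero, zero_add, one_mul]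
    exact phase_spec h₁ h₂ hk₁ hk₂ one_pos hXY (by simpa using hσ)
  | succ L ih =>
    refine ((phase_spec h₁ h₂ hk₁ hk₂ (by positivity) hXY hσ).bind fun τ hτ =>
      ih (pow_succ' (2 : ℤ) L ▸ hτ.1)).mono (le_of_eq ?_) le_rfl fun _ => id
    push_cast
    ring

/-- Find a common base of maximum weight, starting from the common base `D`. -/
noncomputable def maxWeightBase (acc₁ acc₂ : Access Q A α) (k d X Y L : ℕ) (w : α → ℤ)
    (D : Finset α) : ParallelAlg Q A (Finset α) :=
  (scaling acc₁ acc₂ k d X Y (fun e => (k + 1) * w e) L ⟨0, 0, D, D⟩).map Splitting.S₁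

lemma maxWeightBase_spec (h₁ : acc₁.Correct o M₁ t c) (h₂ : acc₂.Correct o M₂ t c)
    (hk₁ : M₁.eRank = k) (hk₂ : M₂.eRank = k) (hXY : PhaseParams (Fintype.card α) k d X Y)
    (hD₁ : M₁.IsBase D) (hD₂ : M₂.IsBase D) (hL : ∀ e, (k + 1) * |w e| ≤ 2 * 2 ^ L) :
    (maxWeightBase acc₁ acc₂ k d X Y L w D).Spec o ((L + 1) * (X * t + (t + Y))) (c + c)
      (IsMaxCommonBase M₁ M₂ w) := by
  have hzero : Splitting.Close M₁ M₂ (fun e => (k + 1) * w e) (2 * 2 ^ L) ⟨0, 0, D, D⟩ := by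
    refine ⟨⟨⟨hD₁, fun _ _ => by simp⟩, ⟨hD₂, fun _ _ => by simp⟩⟩, rfl, fun e => ?_⟩
    simpa [abs_mul, abs_of_nonneg (by positivity : (0 : ℤ) ≤ k + 1)] using hL e
  exact (scaling_spec h₁ h₂ hk₁ hk₂ hXY L hzero).map fun σ hσ => hσ.1.isMaxCommonBase hσ.2 hk₁

end Scaling

section Rank

variable {α : Type*} {M : Matroid α} {X : Finset α} {e : α}

/-- The rank as a natural number. -/
noncomputable def natRank (M : Matroid α) (X : Finset α) : ℕ := (M.eRk X).toNat

lemma coe_natRank (M : Matroid α) (X : Finset α) : (natRank M X : ℕ∞) = M.eRk X :=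
  ENat.natCast_toNat (M.isRkFinite_of_finite X.finite_toSet).eRk_lt_top.ne

lemma indep_iff_natRank : M.Indep X ↔ natRank M X = X.card := by
  rw [Matroid.indep_iff_eRk_eq_encard_of_finite X.finite_toSet, ← coe_natRank,
    Set.encard_coe_eq_coe_finsetCard, Nat.cast_inj]

lemma natRank_insert_ne_iff [DecidableEq α] :
    natRank M (insert e X) ≠ natRank M X ↔ e ∈ M.E \ M.closure X := by
  rw [← Nat.cast_inj (R := ℕ∞) |>.ne, coe_natRank, coe_natRank, Finset.coe_insert]
  refine ⟨fun h => ⟨?_, fun he => ?_⟩, fun he => ?_⟩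
  · exact by_contra fun he => h (M.eRk_insert_of_notMem_ground X he)
  · exact h (by rw [← M.eRk_closure_eq, Matroid.closure_insert_eq_of_mem_closure he,
      M.eRk_closure_eq])
  · rw [Matroid.eRk_insert_eq_add_one he, ← coe_natRank]
    exact_mod_cast Nat.succ_ne_self _

end Rank

section Access

variable {Q Q' A A' α : Type} [DecidableEq α] {M : Matroid α} {o : Q → A} {t : ℝ} {c : ℕ}

lemma isExchange_iff_indep {S : Finset α} {a b : α} (hS : M.IsBase S) :
    IsExchange M S a b ↔ a ∈ S ∧ b ∉ S ∧ M.Indep (insert b (S.erase a) : Finset α) := by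
  refine and_congr_right fun _ => and_congr_right fun hb => ⟨Matroid.IsBase.indep, fun h => ?_⟩
  rw [Finset.coe_insert, Finset.coe_erase] at h ⊢
  exact hS.exchange_isBase_of_indep hb h

variable [Fintype α]

/-- Access to a matroid from procedures that compute ranks and decide independence. -/
noncomputable def Access.ofRank (rank : Finset α → ParallelAlg Q A ℕ)
    (indep : Finset α → ParallelAlg Q A Prop) : Access Q A α where
  base w := (ParallelAlg.all fun e =>
    (rank (insert e (earlier w e))).par (rank (earlier w e))).map fun x =>
      Finset.univ.filter fun e => (x e).1 ≠ (x e).2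
  exchanges S := (ParallelAlg.all fun q : α × α => indep (insert q.2 (S.erase q.1))).map
    fun x a b => a ∈ S ∧ b ∉ S ∧ x (a, b)

lemma Access.ofRank_correct {rank : Finset α → ParallelAlg Q A ℕ}
    {indep : Finset α → ParallelAlg Q A Prop}
    (hr : ∀ X, (rank X).Spec o t c (· = natRank M X))
    (hi : ∀ X : Finset α, (indep X).Spec o 1 1 (· ↔ M.Indep X))
    (hc : Fintype.card α * c ≤ Fintype.card α ^ 2) :
    (Access.ofRank rank indep).Correct o M t (2 * Fintype.card α ^ 2) where
  base w := by
    refine ((ParallelAlg.Spec.all (hr ∅).nonneg fun e =>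
      (hr (insert e (earlier w e))).par (hr (earlier w e))).mono le_rfl ?_ fun _ => id).map ?_
    · linarith
    · intro x hx
      ext e
      rw [Finset.mem_filter_univ, (hx e).1, (hx e).2, natRank_insert_ne_iff, mem_greedyBase]
  exchanges S hS := by
    refine ((ParallelAlg.Spec.all zero_le_one fun q : α × α =>
      hi (insert q.2 (S.erase q.1))).mono le_rfl ?_ fun _ => id).map ?_
    · rw [Fintype.card_prod, mul_one, ← sq]
      exact Nat.le_mul_of_pos_left _ two_pos
    · intro x hx
      ext a b
      rw [hx (a, b), isExchange_iff_indep hS]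

/-- Access to the ranks by queries. -/
noncomputable def Access.rank : Access (Finset α) ℕ α :=
  Access.ofRank ParallelAlg.query fun X => (ParallelAlg.query X).map (· = X.card)

lemma Access.rank_correct {o : Finset α → ℕ} (ho : ∀ X, o X = natRank M X) :
    Access.rank.Correct o M 1 (2 * Fintype.card α ^ 2) := by
  obtain rfl : o = natRank M := funext ho
  refine Access.ofRank_correct ParallelAlg.Spec.query (fun X => ?_) ?_
  · refine (ParallelAlg.Spec.query X).map ?_
    rintro _ rfl
    exact indep_iff_natRank.symm
  · rw [mul_one]
    exact Nat.le_self_pow two_ne_zero _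

/-- Access by means of an oracle for other queries. -/
def Access.simulate (acc : Access Q' A' α) (f : Q' → Q) (g : Q' → A → A') : Access Q A α where
  base w := (acc.base w).simulate f g
  exchanges S := (acc.exchanges S).simulate f g

lemma Access.Correct.simulate {acc : Access Q' A' α} {f : Q' → Q} {g : Q' → A → A'}
    (h : acc.Correct (fun q => g q (o (f q))) M t c) : (acc.simulate f g).Correct o M t c where
  base w := (h.base w).simulate
  exchanges S hS := (h.exchanges S hS).simulate

end Access

section Padding

variable {α : Type*} [DecidableEq α] {M : Matroid α} {k : ℕ}

lemma exists_insert_toLeft_indep {I J : Finset (α ⊕ Fin k)}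
    (hI : M.Indep I.toLeft) (hJ : M.Indep J.toLeft) (hIJ : I.card < J.card) :
    ∃ x ∈ J, x ∉ I ∧ M.Indep (insert x I).toLeft := by
  by_cases h : J.toRight ⊆ I.toRight
  · have := Finset.card_le_card h
    have := Finset.card_toLeft_add_card_toRight (u := I)
    have := Finset.card_toLeft_add_card_toRight (u := J)
    obtain ⟨x, ⟨hxJ, hxI⟩, hx⟩ := hI.augment hJ <| by
      simp only [Set.encard_coe_eq_coe_finsetCard, Nat.cast_lt]
      lia
    exact ⟨.inl x, by simpa using hxJ, by simpa using hxI, by simpa using hx⟩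
  · obtain ⟨y, hyJ, hyI⟩ := Finset.not_subset.1 h
    exact ⟨.inr y, by simpa using hyJ, by simpa using hyI, by simpa using hI⟩

/-- The matroid `M` extended by `k` free elements and truncated to rank `k`. Its bases are the
independent sets of `M` with at most `k` elements, filled up with free elements. -/
def pad (M : Matroid α) (k : ℕ) : Matroid (α ⊕ Fin k) :=
  (IndepMatroid.ofFinset Set.univ (fun I => M.Indep I.toLeft ∧ I.card ≤ k)
    (by simp [Finset.toLeft])
    (fun I J hJ hIJ => ⟨hJ.1.subset (Finset.coe_subset.2 (Finset.toLeft_subset_toLeft hIJ)),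
      (Finset.card_le_card hIJ).trans hJ.2⟩)
    (fun I J hI hJ hIJ => by
      obtain ⟨x, hxJ, hxI, hx⟩ := exists_insert_toLeft_indep hI.1 hJ.1 hIJ
      exact ⟨x, hxJ, hxI, hx, (Finset.card_insert_of_notMem hxI).trans_le (hIJ.trans_le hJ.2)⟩)
    fun _ _ => Set.subset_univ _).matroid

lemma pad_indep {I : Finset (α ⊕ Fin k)} :
    (pad M k).Indep I ↔ M.Indep I.toLeft ∧ I.card ≤ k := by
  simp only [pad, IndepMatroid.matroid_Indep, IndepMatroid.ofFinset_indep]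

lemma natRank_pad [Finite α] (M : Matroid α) (k : ℕ) (X : Finset (α ⊕ Fin k)) :
    natRank (pad M k) X = min k (natRank M X.toLeft + X.toRight.card) := by
  apply le_antisymm
  · rw [← Nat.cast_le (α := ℕ∞), coe_natRank, Matroid.eRk_le_iff]
    intro J hJX hJ
    lift J to Finset (α ⊕ Fin k) using Set.toFinite J
    rw [Finset.coe_subset] at hJX
    rw [pad_indep] at hJ
    rw [Set.encard_coe_eq_coe_finsetCard, Nat.cast_le, ← Finset.card_toLeft_add_card_toRight]
    refine le_min (Finset.card_toLeft_add_card_toRight.trans_le hJ.2) (Nat.add_le_add ?_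
      (Finset.card_le_card (Finset.toRight_subset_toRight hJX)))
    rw [← Nat.cast_le (α := ℕ∞), coe_natRank, ← Set.encard_coe_eq_coe_finsetCard]
    exact hJ.1.encard_le_eRk_of_subset (Finset.coe_subset.2 (Finset.toLeft_subset_toLeft hJX))
  · obtain ⟨I, hI⟩ := M.exists_isBasis' X.toLeft
    lift I to Finset α using Set.toFinite I
    have hcard : natRank M X.toLeft = I.card := by
      rw [← Nat.cast_inj (R := ℕ∞), coe_natRank, hI.eRk_eq_encard, Set.encard_coe_eq_coe_finsetCard]
    obtain ⟨Z, hZ, hZk⟩ := Finset.exists_subset_card_eq (s := I.disjSum X.toRight)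
      (n := min k (natRank M X.toLeft + X.toRight.card))
      (by rw [Finset.card_disjSum, hcard]; exact min_le_right _ _)
    have hZI := Finset.subset_disjSum.1 hZ
    rw [← hZk, ← Nat.cast_le (α := ℕ∞), coe_natRank, ← Set.encard_coe_eq_coe_finsetCard]
    refine Matroid.Indep.encard_le_eRk_of_subset (pad_indep.2
      ⟨hI.indep.subset (Finset.coe_subset.2 hZI.1), hZk.trans_le (min_le_left _ _)⟩) ?_
    refine Finset.coe_subset.2 (hZ.trans (Finset.disjSum_subset.2 ⟨?_, le_rfl⟩))
    exact Finset.coe_subset.1 hI.subset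

lemma eRank_pad [Finite α] (M : Matroid α) (k : ℕ) : (pad M k).eRank = k := by
  have := Fintype.ofFinite α
  have huniv : (Finset.univ : Finset (α ⊕ Fin k)).toRight = Finset.univ := by ext; simp
  have hE : (pad M k).E = (Finset.univ : Finset (α ⊕ Fin k)) := Finset.coe_univ.symm
  rw [← Matroid.eRk_ground, hE, ← coe_natRank, natRank_pad, huniv, Finset.card_fin,
    min_eq_left (Nat.le_add_left _ _)]

lemma isBase_pad_iff [Finite α] {B : Finset (α ⊕ Fin k)} :
    (pad M k).IsBase B ↔ M.Indep B.toLeft ∧ B.card = k := by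
  refine ⟨fun hB => ⟨(pad_indep.1 hB.indep).1, card_eq_of_isBase hB (eRank_pad M k)⟩, fun h => ?_⟩
  have hB : (pad M k).Indep B := pad_indep.2 ⟨h.1, h.2.le⟩
  refine hB.isBase_of_eRk_ge B.finite_toSet ?_
  rw [eRank_pad, hB.eRk_eq_encard, Set.encard_coe_eq_coe_finsetCard, h.2]

end Padding

section Grid

variable {α : Type*} {s : ℕ} {R : Finset α} {ok : Fin (R.card / s) × Fin s → Prop}
  {j : Fin (R.card / s)} {m : ℕ}

/-- The elements of `R`, up to a remainder, arranged in columns of length `s`. -/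
noncomputable def grid (s : ℕ) (R : Finset α) : Fin (R.card / s) × Fin s ↪ α :=
  finProdFinEquiv.toEmbedding.trans <| (Fin.castLEEmb (Nat.div_mul_le_self R.card s)).trans <|
    R.equivFin.symm.toEmbedding.trans (Function.Embedding.subtype _)

lemma grid_mem (x : Fin (R.card / s) × Fin s) : grid s R x ∈ R := (R.equivFin.symm _).2

/-- The first `m` elements of the column `j`. -/
noncomputable def column (s : ℕ) (R : Finset α) (j : Fin (R.card / s)) (m : ℕ) : Finset α :=
  (Finset.univ.filter fun i : Fin s => (i : ℕ) < m).map
    ((Function.Embedding.sectR j (Fin s)).trans (grid s R))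

lemma mem_column {e : α} :
    e ∈ column s R j m ↔ ∃ i : Fin s, (i : ℕ) < m ∧ grid s R (j, i) = e := by
  simp [column]

lemma column_subset (m : ℕ) : column s R j m ⊆ R := by
  intro e he
  obtain ⟨i, -, rfl⟩ := mem_column.1 he
  exact grid_mem _

lemma column_zero : column s R j 0 = ∅ := by simp [column]

lemma column_succ [DecidableEq α] (i : Fin s) :
    column s R j (i + 1) = insert (grid s R (j, i)) (column s R j i) := by
  ext e
  simp only [mem_column, Finset.mem_insert, Nat.lt_succ_iff_lt_or_eq, or_and_right, exists_or,
    ← Fin.ext_iff, exists_eq_left, or_comm, eq_comm (a := e)]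

lemma card_column : (column s R j s).card = s := by simp [column]

open scoped Classical in
/-- For each column, its first element that is not accepted, if there is one. -/
noncomputable def firstRejected (s : ℕ) (R : Finset α) (ok : Fin (R.card / s) × Fin s → Prop) :
    Finset α :=
  (Finset.univ.filter fun x => ¬ok x ∧ ∀ i < x.2, ok (x.1, i)).map (grid s R)

lemma mem_firstRejected {e : α} :
    e ∈ firstRejected s R ok ↔ ∃ x, (¬ok x ∧ ∀ i < x.2, ok (x.1, i)) ∧ grid s R x = e := by
  simp [firstRejected]

lemma firstRejected_subset : firstRejected s R ok ⊆ R := by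
  intro e he
  obtain ⟨x, -, rfl⟩ := mem_firstRejected.1 he
  exact grid_mem x

lemma card_firstRejected (h : ∀ j, ∃ i, ¬ok (j, i)) :
    R.card / s ≤ (firstRejected s R ok).card := by
  classical
  have hfirst : ∀ j, ∃ i, ¬ok (j, i) ∧ ∀ i' < i, ok (j, i') := fun j => by
    obtain ⟨i, hi, hmin⟩ := WellFounded.has_min wellFounded_lt {i | ¬ok (j, i)} (h j)
    exact ⟨i, hi, fun i' hlt => by_contra fun h' => hmin i' h' hlt⟩
  choose first hfirst using hfirst
  calc R.card / s = (Finset.univ.image fun j => (j, first j)).card := by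
        rw [Finset.card_image_of_injective _ fun j j' h => (Prod.ext_iff.1 h).1, Finset.card_fin]
    _ ≤ (Finset.univ.filter fun x => ¬ok x ∧ ∀ i < x.2, ok (x.1, i)).card := by
        refine Finset.card_le_card (Finset.image_subset_iff.2 fun j _ => ?_)
        exact (Finset.mem_filter_univ _).2 (hfirst j)
    _ = (firstRejected s R ok).card := (Finset.card_map _).symm

end Grid

section PartialBasis

variable {α : Type*} [DecidableEq α] {M : Matroid α} {s : ℕ} {X I R : Finset α}

/-- Some elements of `R` extend the independent set `I` to a basis of `X`. -/
structure IsPartialBasis (M : Matroid α) (X I R : Finset α) : Prop where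
  indep : M.Indep I
  disjoint : Disjoint I R
  closure : M.closure (I ∪ R : Finset α) = M.closure X

lemma isPartialBasis_empty (M : Matroid α) (X : Finset α) : IsPartialBasis M X ∅ X :=
  ⟨by simp, by simp, by simp⟩

lemma IsPartialBasis.card_eq (h : IsPartialBasis M X I ∅) : I.card = natRank M X := by
  rw [← Nat.cast_inj (R := ℕ∞), coe_natRank, ← M.eRk_closure_eq, ← h.closure, Finset.union_empty,
    M.eRk_closure_eq, h.indep.eRk_eq_encard, Set.encard_coe_eq_coe_finsetCard]

open scoped Classical in
/-- A step of the search for a basis: if some column is accepted entirely, it is added to `I`, and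
otherwise the first rejected element of every column is discarded. -/
noncomputable def basisStep (s : ℕ) (I R : Finset α) (ok : Fin (R.card / s) × Fin s → Prop) :
    Finset α × Finset α :=
  if h : ∃ j, ∀ i, ok (j, i) then (I ∪ column s R h.choose s, R \ column s R h.choose s)
  else (I, R \ firstRejected s R ok)

variable {ok : Fin (R.card / s) × Fin s → Prop}

/-- How a step of the search changes the cardinalities `a` and `m` of `I` and `R`. -/
def StepSizes (s a m a' m' : ℕ) : Prop := (a' = a + s ∧ m' + s = m) ∨ (a' = a ∧ m' + m / s ≤ m)

lemma basisStep_sizes (hIR : Disjoint I R) :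
    StepSizes s I.card R.card (basisStep s I R ok).1.card (basisStep s I R ok).2.card := by
  unfold basisStep
  split_ifs with hj
  · left
    have hsub := column_subset (s := s) (R := R) (j := hj.choose) s
    have hcard := Finset.card_sdiff_add_card_eq_card hsub
    rw [card_column] at hcard
    exact ⟨by rw [Finset.card_union_of_disjoint (hIR.mono_right hsub), card_column], hcard⟩
  · right
    push Not at hj
    have hcard := Finset.card_sdiff_add_card_eq_card (firstRejected_subset (ok := ok))
    exact ⟨rfl, (Nat.add_le_add_left (card_firstRejected hj) _).trans_eq hcard⟩

lemma indep_union_column (hI : M.Indep I)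
    (hok : ∀ x, ok x ↔ M.Indep (I ∪ column s R x.1 (x.2 + 1) : Finset α)) {j : Fin (R.card / s)}
    {m : ℕ} (hm : m ≤ s) (h : ∀ i : Fin s, (i : ℕ) < m → ok (j, i)) :
    M.Indep (I ∪ column s R j m : Finset α) := by
  cases m with
  | zero => rwa [column_zero, Finset.union_empty]
  | succ m => exact (hok (j, ⟨m, hm⟩)).1 (h _ (Nat.lt_succ_self m))

lemma mem_closure_of_mem_firstRejected (hI : M.Indep I)
    (hok : ∀ x, ok x ↔ M.Indep (I ∪ column s R x.1 (x.2 + 1) : Finset α)) {e : α}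
    (he : e ∈ firstRejected s R ok) (heE : e ∈ M.E) :
    e ∈ M.closure (I ∪ (R \ firstRejected s R ok) : Finset α) := by
  obtain ⟨⟨j, i⟩, ⟨hrej, hacc⟩, rfl⟩ := mem_firstRejected.1 he
  have hindep := indep_union_column hI hok (m := i) i.2.le fun i' h => hacc i' h
  rw [hok, column_succ, Finset.union_insert, Finset.coe_insert, hindep.insert_indep_iff] at hrej
  push Not at hrej
  refine M.closure_subset_closure ?_ (by_contra fun h => hrej.1 ⟨heE, h⟩)
  refine Finset.coe_subset.2 (Finset.union_subset_union_right fun e' he' => ?_)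
  refine Finset.mem_sdiff.2 ⟨column_subset _ he', fun hrej' => ?_⟩
  obtain ⟨i', hi', rfl⟩ := mem_column.1 he'
  obtain ⟨x, hx, hxe⟩ := mem_firstRejected.1 hrej'
  obtain rfl := (grid s R).injective hxe
  exact hx.1 (hacc i' hi')

lemma closure_union_sdiff_firstRejected (hI : M.Indep I)
    (hok : ∀ x, ok x ↔ M.Indep (I ∪ column s R x.1 (x.2 + 1) : Finset α)) :
    M.closure (I ∪ (R \ firstRejected s R ok) : Finset α) = M.closure (I ∪ R : Finset α) := by
  refine (M.closure_subset_closure ?_).antisymm ?_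
  · exact Finset.coe_subset.2 (Finset.union_subset_union_right Finset.sdiff_subset)
  · rw [← M.closure_inter_ground (I ∪ R : Finset α)]
    refine M.closure_subset_closure_of_subset_closure fun e ⟨he, heE⟩ => ?_
    by_cases hrej : e ∈ firstRejected s R ok
    · exact mem_closure_of_mem_firstRejected hI hok hrej heE
    · refine M.mem_closure_of_mem' ?_ heE
      rw [Finset.mem_coe, Finset.mem_union] at he ⊢
      exact he.imp_right fun heR => Finset.mem_sdiff.2 ⟨heR, hrej⟩

lemma IsPartialBasis.basisStep (h : IsPartialBasis M X I R)
    (hok : ∀ x, ok x ↔ M.Indep (I ∪ column s R x.1 (x.2 + 1) : Finset α)) :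
    IsPartialBasis M X (basisStep s I R ok).1 (basisStep s I R ok).2 := by
  unfold MatroidIntersection.basisStep
  split_ifs with hj
  · refine ⟨indep_union_column h.indep hok le_rfl fun i _ => hj.choose_spec i, ?_, ?_⟩
    · exact Finset.disjoint_union_left.2
        ⟨h.disjoint.mono_right Finset.sdiff_subset, Finset.disjoint_sdiff⟩
    · rw [Finset.union_assoc, Finset.union_sdiff_of_subset (column_subset s), h.closure]
  · exact ⟨h.indep, h.disjoint.mono_right Finset.sdiff_subset,
      (closure_union_sdiff_firstRejected h.indep hok).trans h.closure⟩

end PartialBasis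

section Potential

variable {s k m m' a a' : ℕ}

/-- The potential that controls the search for a basis in rank `k` by columns of length `s`. -/
noncomputable def searchPotential (s k a m : ℕ) : ℝ :=
  ((k : ℝ) - a) / s + 2 * s * Real.log (m / k)

lemma searchPotential_nonneg (hk : 0 < k) (ha : a ≤ k) (hm : k ≤ m) :
    0 ≤ searchPotential s k a m := by
  have hlog : 0 ≤ Real.log (m / k) :=
    Real.log_nonneg ((one_le_div (by positivity)).2 (by exact_mod_cast hm))
  have hka : (0 : ℝ) ≤ k - a := sub_nonneg.2 (by exact_mod_cast ha)
  unfold searchPotential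
  positivity

lemma log_div_add_le (hk : 0 < k) (hs : 0 < s) (hsm : s ≤ m) (hm' : 0 < m')
    (h : m' + m / s ≤ m) : Real.log (m' / k) + 1 / (2 * s) ≤ Real.log (m / k) := by
  have hm : 0 < m := hs.trans_le hsm
  have hdiv : m ≤ m / s * (2 * s) := by
    have := Nat.lt_mul_of_div_lt (Nat.lt_succ_self (m / s)) hs
    have := (Nat.one_le_div_iff hs).2 hsm
    nlinarith
  have hratio : (m' : ℝ) / m ≤ 1 - 1 / (2 * s) := by
    rw [div_le_iff₀ (by positivity), sub_mul, one_mul, div_mul_eq_mul_div, one_mul, le_sub_comm,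
      div_le_iff₀ (by positivity), ← Nat.cast_sub (le_of_add_le_left h)]
    exact_mod_cast hdiv.trans (Nat.mul_le_mul_right _ (Nat.le_sub_of_add_le' h))
  calc Real.log (m' / k) + 1 / (2 * s)
      = Real.log (m / k) + Real.log (m' / m) + 1 / (2 * s) := by
        rw [← Real.log_mul (by positivity) (by positivity)]
        congr 2
        field_simp
    _ ≤ Real.log (m / k) := by
        have := Real.log_le_sub_one_of_pos (x := (m' : ℝ) / m) (by positivity)
        linarith

lemma StepSizes.le (h : StepSizes s a m a' m') : m' ≤ m := by
  rcases h with h | h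
  · exact le_of_add_le_left h.2.le
  · exact le_of_add_le_left h.2

lemma StepSizes.potential (h : StepSizes s a m a' m') (hk : 0 < k) (hs : 0 < s) (hsm : s ≤ m)
    (hm' : 0 < m') : searchPotential s k a' m' + 1 ≤ searchPotential s k a m := by
  unfold searchPotential
  rcases h with ⟨rfl, rfl⟩ | ⟨rfl, h⟩
  · have hlog : Real.log (m' / k) ≤ Real.log ((m' + s : ℕ) / k) :=
      Real.log_le_log (by positivity) (by gcongr; omega)
    have hstep : ((k : ℝ) - (a + s : ℕ)) / s + 1 = (k - a) / s := by
      push_cast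
      field_simp
      ring
    linarith [mul_le_mul_of_nonneg_left hlog (by positivity : (0 : ℝ) ≤ 2 * s)]
  · have hlog := mul_le_mul_of_nonneg_left (log_div_add_le hk hs hsm hm' h)
      (by positivity : (0 : ℝ) ≤ 2 * s)
    have hone : 2 * (s : ℝ) * (1 / (2 * s)) = 1 := by field_simp
    linarith

lemma StepSizes.sqrt (h : StepSizes s a m a' m') (hm : 0 < m) (hsm : s * s ≤ m)
    (hms : m ≤ 9 * (s * s)) : 6 * √m' + 1 ≤ 6 * √m := by
  have hs : 0 < s := Nat.pos_of_ne_zero (by rintro rfl; omega)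
  have hdec : m' + s ≤ m := by
    rcases h with h | h
    · exact h.2.le
    · exact (Nat.add_le_add_left ((Nat.le_div_iff_mul_le hs).2 hsm) _).trans h.2
  have hdec' : (m' : ℝ) + s ≤ m := by exact_mod_cast hdec
  have hge : 1 ≤ √(m : ℝ) := Real.one_le_sqrt.2 (by exact_mod_cast hm)
  have hle : √(m : ℝ) ≤ 3 * s := by
    rw [Real.sqrt_le_left (by positivity)]
    exact_mod_cast hms.trans_eq (by ring)
  have hroot : √(m' : ℝ) ≤ √m - 1 / 6 := by
    rw [Real.sqrt_le_left (by linarith)]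
    nlinarith [Real.sq_sqrt (Nat.cast_nonneg (α := ℝ) m)]
  linarith

/-- The length of the columns in the search for a basis in rank `k` among `m` elements. -/
def columnLength (k m : ℕ) : ℕ := Nat.sqrt (min k m)

lemma columnLength_bounds (hm : m ≤ 2 * k) :
    columnLength k m * columnLength k m ≤ m ∧ m ≤ 9 * (columnLength k m * columnLength k m) := by
  have h := Nat.sqrt_le (min k m)
  have h' := Nat.sqrt_le_add (min k m)
  unfold columnLength
  refine ⟨h.trans (min_le_right _ _), ?_⟩
  rcases (Nat.sqrt (min k m)).eq_zero_or_pos with h0 | h0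
  · rw [h0] at h' ⊢
    omega
  · have : m ≤ 2 * min k m := by omega
    nlinarith

/-- How many steps reduce the number of remaining elements from `n` to at most `2k`. -/
noncomputable def largeSteps (n k : ℕ) : ℕ :=
  ⌊searchPotential (Nat.sqrt k) k 0 n⌋₊ + 1

/-- How many steps deal with `2k` remaining elements. -/
noncomputable def smallSteps (k : ℕ) : ℕ := ⌊6 * √(2 * k)⌋₊ + 1

end Potential

section Search

variable {Q A α : Type} [DecidableEq α] {M : Matroid α} {o : Q → A} {k : ℕ} {X : Finset α}
  {test : Finset α → ParallelAlg Q A Prop}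

/-- A round of the search for a basis: a step that tests the initial segments of all columns. -/
noncomputable def searchRound (test : Finset α → ParallelAlg Q A Prop) (k : ℕ)
    (p : Finset α × Finset α) : ParallelAlg Q A (Finset α × Finset α) :=
  (ParallelAlg.all fun x => test (p.1 ∪ column (columnLength k p.2.card) p.2 x.1 (x.2 + 1))).map
    (basisStep (columnLength k p.2.card) p.1 p.2)

variable [Fintype α]

/-- The rank of `X` by a search for a basis of `X`. -/
noncomputable def searchRank (test : Finset α → ParallelAlg Q A Prop) (k : ℕ) (X : Finset α) :
    ParallelAlg Q A ℕ :=
  ((ParallelAlg.iter (searchRound test k) (largeSteps (Fintype.card α) k) (∅, X)).bind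
    (ParallelAlg.iter (searchRound test k) (smallSteps k))).map fun p => p.1.card

lemma searchRound_spec (htest : ∀ X : Finset α, (test X).Spec o 1 1 (· ↔ M.Indep X))
    {p : Finset α × Finset α} (hp : IsPartialBasis M X p.1 p.2) :
    (searchRound test k p).Spec o 1 (Fintype.card α) fun p' => IsPartialBasis M X p'.1 p'.2 ∧
      StepSizes (columnLength k p.2.card) p.1.card p.2.card p'.1.card p'.2.card := by
  refine ((ParallelAlg.Spec.all zero_le_one fun x => htest _).mono le_rfl ?_ fun _ => id).map
    fun ok hok => ⟨hp.basisStep hok, basisStep_sizes hp.disjoint⟩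
  rw [Fintype.card_prod, Fintype.card_fin, Fintype.card_fin, mul_one]
  exact (Nat.div_mul_le_self _ _).trans (Finset.card_le_univ _)

lemma largeSteps_spec (htest : ∀ X : Finset α, (test X).Spec o 1 1 (· ↔ M.Indep X))
    (hk : M.eRank = k) (hk₀ : 0 < k) :
    (ParallelAlg.iter (searchRound test k) (largeSteps (Fintype.card α) k) (∅, X)).Spec o
      (largeSteps (Fintype.card α) k) (Fintype.card α)
      fun p => IsPartialBasis M X p.1 p.2 ∧ p.2.card ≤ 2 * k := by
  have hs : 0 < Nat.sqrt k := Nat.sqrt_pos.2 hk₀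
  have hsk : Nat.sqrt k ≤ k := Nat.sqrt_le_self k
  refine ((ParallelAlg.Spec.iter (t := 1) (c := Fintype.card α) (I := fun i p =>
    IsPartialBasis M X p.1 p.2 ∧ (p.2.card ≤ 2 * k ∨
      searchPotential (Nat.sqrt k) k p.1.card p.2.card + i ≤
        searchPotential (Nat.sqrt k) k 0 (Fintype.card α))) ?_ _ ?_).mono (mul_one _).le le_rfl ?_)
  · rintro i p ⟨hp, hp'⟩
    refine (searchRound_spec htest hp).mono le_rfl le_rfl fun p' ⟨hbasis, hsizes⟩ => ⟨hbasis, ?_⟩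
    refine or_iff_not_imp_left.2 fun hlarge => ?_
    have hle := hsizes.le
    rw [columnLength, min_eq_left (by omega)] at hsizes
    have := hsizes.potential hk₀ hs (by omega) (by omega)
    have := hp'.resolve_left (by omega)
    push_cast
    linarith
  · refine ⟨isPartialBasis_empty M X, or_iff_not_imp_left.2 fun (hlarge : ¬X.card ≤ 2 * k) => ?_⟩
    have hX : 0 < X.card := by omega
    rw [Finset.card_empty, Nat.cast_zero, add_zero]
    unfold searchPotential
    gcongr
    exact Finset.card_le_univ X
  · rintro p ⟨hp, hp'⟩
    refine ⟨hp, hp'.elim id fun h => le_of_not_gt fun hlarge => ?_⟩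
    have hpk : p.1.card ≤ k := by
      rw [← Nat.cast_le (α := ℕ∞), ← hk, ← Set.encard_coe_eq_coe_finsetCard]
      exact hp.indep.encard_le_eRank
    have := searchPotential_nonneg (s := Nat.sqrt k) hk₀ hpk (by omega : k ≤ p.2.card)
    have := Nat.lt_floor_add_one (searchPotential (Nat.sqrt k) k 0 (Fintype.card α))
    rw [largeSteps, Nat.cast_add, Nat.cast_one] at h
    linarith

lemma smallSteps_spec (htest : ∀ X : Finset α, (test X).Spec o 1 1 (· ↔ M.Indep X))
    {p : Finset α × Finset α} (hp : IsPartialBasis M X p.1 p.2) (hpk : p.2.card ≤ 2 * k) :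
    (ParallelAlg.iter (searchRound test k) (smallSteps k) p).Spec o (smallSteps k) (Fintype.card α)
      fun p => IsPartialBasis M X p.1 ∅ := by
  refine ((ParallelAlg.Spec.iter (t := 1) (c := Fintype.card α) (I := fun i p =>
    IsPartialBasis M X p.1 p.2 ∧ p.2.card ≤ 2 * k ∧ (p.2 = ∅ ∨
      6 * √p.2.card + i ≤ 6 * √(2 * k))) ?_ _ ?_).mono (mul_one _).le le_rfl ?_)
  · rintro i p ⟨hp, hpk, hp'⟩
    refine (searchRound_spec htest hp).mono le_rfl le_rfl fun p' ⟨hbasis, hsizes⟩ =>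
      ⟨hbasis, hsizes.le.trans hpk, or_iff_not_imp_left.2 fun hne => ?_⟩
    have hpos : 0 < p.2.card :=
      (Finset.card_pos.2 (Finset.nonempty_iff_ne_empty.2 hne)).trans_le hsizes.le
    have hlength := columnLength_bounds hpk
    have := hsizes.sqrt hpos hlength.1 hlength.2
    have := hp'.resolve_left (Finset.card_pos.1 hpos).ne_empty
    push_cast
    linarith
  · refine ⟨hp, hpk, .inr ?_⟩
    rw [Nat.cast_zero, add_zero]
    gcongr
    exact_mod_cast hpk
  · rintro ⟨I, R⟩ ⟨hp, -, hp'⟩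
    have hR : R = ∅ := hp'.elim id fun h => by
      have := Nat.lt_floor_add_one (6 * √(2 * k))
      rw [smallSteps, Nat.cast_add, Nat.cast_one] at h
      linarith [Real.sqrt_nonneg R.card]
    exact hR ▸ hp

/-- The number of rounds of the search for a basis in rank `k` among `n` elements. -/
noncomputable def searchRounds (n k : ℕ) : ℕ := largeSteps n k + smallSteps k

lemma searchRank_spec (htest : ∀ X : Finset α, (test X).Spec o 1 1 (· ↔ M.Indep X))
    (hk : M.eRank = k) (hk₀ : 0 < k) (X : Finset α) :
    (searchRank test k X).Spec o (searchRounds (Fintype.card α) k) (Fintype.card α)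
      (· = natRank M X) := by
  rw [searchRounds, Nat.cast_add]
  exact ((largeSteps_spec htest hk hk₀).bind fun p hp => smallSteps_spec htest hp.1 hp.2).map
    fun p hp => hp.card_eq

/-- Access to a matroid of rank `k` by independence queries. -/
noncomputable def Access.indep (k : ℕ) : Access (Finset α) Bool α :=
  Access.ofRank (searchRank (fun X => (ParallelAlg.query X).map (· = true)) k)
    fun X => (ParallelAlg.query X).map (· = true)

lemma Access.indep_correct {o : Finset α → Bool} (ho : ∀ X : Finset α, o X = true ↔ M.Indep X)
    (hk : M.eRank = k) (hk₀ : 0 < k) : (Access.indep k).Correct o M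
      (searchRounds (Fintype.card α) k) (2 * Fintype.card α ^ 2) := by
  have htest (X : Finset α) :
      ((ParallelAlg.query X).map (· = true)).Spec o 1 1 (· ↔ M.Indep X) :=
    (ParallelAlg.Spec.query X).map (by rintro _ rfl; exact ho X)
  exact Access.ofRank_correct (searchRank_spec htest hk hk₀) htest (sq _).ge

end Search

section PaddedAccess

variable {Q α : Type} [Fintype α] [DecidableEq α] {M : Matroid α} {k : ℕ} {f : Finset α → Q}

/-- Access to `pad M k` by the rank queries `f X` about `M`. -/
noncomputable def padAccessRank (k : ℕ) (f : Finset α → Q) : Access Q ℕ (α ⊕ Fin k) :=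
  Access.rank.simulate (fun X => f X.toLeft) fun X a => min k (a + X.toRight.card)

lemma padAccessRank_correct {o : Q → ℕ} (ho : ∀ X, o (f X) = natRank M X) :
    (padAccessRank k f).Correct o (pad M k) 1 (2 * (Fintype.card α + k) ^ 2) := by
  rw [show Fintype.card α + k = Fintype.card (α ⊕ Fin k) by simp]
  exact (Access.rank_correct fun X => by rw [ho, natRank_pad]).simulate

/-- Access to `pad M k` by the independence queries `f X` about `M`. -/
noncomputable def padAccessIndep (k : ℕ) (f : Finset α → Q) : Access Q Bool (α ⊕ Fin k) :=
  (Access.indep k).simulate (fun X => f X.toLeft) fun X a => a && decide (X.card ≤ k)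

lemma padAccessIndep_correct {o : Q → Bool} (ho : ∀ X : Finset α, o (f X) = true ↔ M.Indep X)
    (hk : 0 < k) : (padAccessIndep k f).Correct o (pad M k)
      (searchRounds (Fintype.card α + k) k) (2 * (Fintype.card α + k) ^ 2) := by
  rw [show Fintype.card α + k = Fintype.card (α ⊕ Fin k) by simp]
  refine (Access.indep_correct (fun X => ?_) (eRank_pad M k) hk).simulate
  rw [Bool.and_eq_true, ho, decide_eq_true_iff, pad_indep]

end PaddedAccess

section Truncated

variable {n k : ℕ} {M₁ M₂ : Matroid (Fin n)} {w : Fin n → ℤ} {S T : Finset (Fin n)}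

lemma card_le_commonRank (hS : CommonIndep M₁ M₂ S) : S.card ≤ commonRank M₁ M₂ := by
  classical
  exact Finset.le_sup (f := Finset.card) ((Finset.mem_filter_univ S).2 hS)

lemma exists_card_eq_commonRank (M₁ M₂ : Matroid (Fin n)) :
    ∃ T, CommonIndep M₁ M₂ T ∧ T.card = commonRank M₁ M₂ := by
  classical
  obtain ⟨T, hT, hcard⟩ := Finset.exists_mem_eq_sup
    (Finset.univ.filter fun S : Finset (Fin n) => CommonIndep M₁ M₂ S)
    ⟨∅, (Finset.mem_filter_univ _).2 (by simp [CommonIndep])⟩ Finset.card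
  refine ⟨T, (Finset.mem_filter_univ T).1 hT, hcard.symm.trans ?_⟩
  unfold commonRank
  congr!

lemma commonRank_le (M₁ M₂ : Matroid (Fin n)) : commonRank M₁ M₂ ≤ n := by
  obtain ⟨T, -, hT⟩ := exists_card_eq_commonRank M₁ M₂
  exact hT ▸ card_finset_fin_le T

/-- `S` has maximum weight among the common independent sets with at most `k` elements. -/
def IsMaxWeightUpTo (M₁ M₂ : Matroid (Fin n)) (w : Fin n → ℤ) (k : ℕ) (S : Finset (Fin n)) :
    Prop :=
  CommonIndep M₁ M₂ S ∧ S.card ≤ k ∧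
    ∀ T, CommonIndep M₁ M₂ T → T.card ≤ k → ∑ e ∈ T, w e ≤ ∑ e ∈ S, w e

lemma IsMaxWeightUpTo.isMaxWeight (h : IsMaxWeightUpTo M₁ M₂ w k S) (hk : commonRank M₁ M₂ ≤ k) :
    IsMaxWeight M₁ M₂ w S :=
  ⟨h.1, fun T hT => h.2.2 T hT ((card_le_commonRank hT).trans hk)⟩

lemma IsMaxWeightUpTo.card_eq (h : IsMaxWeightUpTo M₁ M₂ 1 k S) :
    S.card = min k (commonRank M₁ M₂) := by
  refine le_antisymm (le_min h.2.1 (card_le_commonRank h.1)) ?_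
  obtain ⟨T, hT, hcard⟩ := exists_card_eq_commonRank M₁ M₂
  obtain ⟨U, hUT, hU⟩ := Finset.exists_subset_card_eq (hcard ▸ min_le_right k (commonRank M₁ M₂))
  have hle := h.2.2 U ⟨hT.1.subset (Finset.coe_subset.2 hUT), hT.2.subset (Finset.coe_subset.2 hUT)⟩
    (hU.trans_le (min_le_left _ _))
  simp only [Pi.one_apply, Finset.sum_const, nsmul_eq_mul, mul_one, Nat.cast_le] at hle
  rwa [hU, hcard] at hle

lemma sum_elim_zero (w : Fin n → ℤ) (B : Finset (Fin n ⊕ Fin k)) :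
    ∑ e ∈ B, Sum.elim w 0 e = ∑ e ∈ B.toLeft, w e := by
  conv_lhs => rw [← B.toLeft_disjSum_toRight]
  simp [Finset.sum_disjSum]

lemma IsMaxCommonBase.toLeft {B : Finset (Fin n ⊕ Fin k)}
    (h : IsMaxCommonBase (pad M₁ k) (pad M₂ k) (Sum.elim w 0) B) :
    IsMaxWeightUpTo M₁ M₂ w k B.toLeft := by
  obtain ⟨hB₁, hB₂, hmax⟩ := h
  rw [isBase_pad_iff] at hB₁ hB₂
  refine ⟨⟨hB₁.1, hB₂.1⟩, Finset.card_toLeft_le.trans hB₁.2.le, fun T hT hTk => ?_⟩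
  obtain ⟨Z, -, hZ⟩ := Finset.exists_subset_card_eq (s := (Finset.univ : Finset (Fin k)))
    (n := k - T.card) (by simp)
  have hcard : (T.disjSum Z).card = k := by
    rw [Finset.card_disjSum, hZ, Nat.add_sub_cancel' hTk]
  have hle := hmax (T.disjSum Z) (isBase_pad_iff.2 ⟨by simpa using hT.1, hcard⟩)
    (isBase_pad_iff.2 ⟨by simpa using hT.2, hcard⟩)
  simpa only [sum_elim_zero, Finset.toLeft_disjSum] using hle

end Truncated

section Parameters

variable {k n : ℕ} {t b : ℝ}

lemma exists_phaseParams (hk : 0 < k) (ht : 0 ≤ t) (hb : 1 ≤ b) (hbt : (n : ℝ) * k * t ≤ b ^ 3) :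
    ∃ d X Y : ℕ, PhaseParams n k d X Y ∧ X * t + (t + Y) ≤ 15 * b + 2 * t := by
  have hb₀ : 0 < b := zero_lt_one.trans_le hb
  have hk₀ : (0 : ℝ) < k := by exact_mod_cast hk
  obtain hd | hd := (⌊(k : ℝ) / b⌋₊).eq_zero_or_pos
  · have hkb : (k : ℝ) < b := (div_lt_one hb₀).1 (Nat.floor_eq_zero.1 hd)
    exact ⟨0, 0, k, .inl le_rfl, by rw [Nat.cast_zero, zero_mul]; linarith⟩
  set d := ⌊(k : ℝ) / b⌋₊
  have hdle : (d : ℝ) ≤ k / b := Nat.floor_le (by positivity)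
  have hdge : (k : ℝ) / b ≤ 2 * d := by
    have : (1 : ℝ) ≤ d := by exact_mod_cast hd
    linarith [Nat.lt_floor_add_one ((k : ℝ) / b)]
  refine ⟨d, 2 * d ^ 2 * n / k + 1, 6 * k / d + 1, .inr ⟨?_, hd, ?_⟩, ?_⟩
  · exact Nat.lt_mul_of_div_lt (Nat.lt_succ_self _) hk
  · exact (Nat.lt_mul_of_div_lt (Nat.lt_succ_self _) hd).le
  · have hX : ((2 * d ^ 2 * n / k : ℕ) : ℝ) * t ≤ 2 * b := by
      calc ((2 * d ^ 2 * n / k : ℕ) : ℝ) * t ≤ 2 * d ^ 2 * n / k * t := by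
            gcongr
            exact_mod_cast Nat.cast_div_le (α := ℝ)
        _ ≤ 2 * (k / b) ^ 2 * n / k * t := by gcongr
        _ = 2 * (n * k * t) / b ^ 2 := by field_simp
        _ ≤ 2 * b ^ 3 / b ^ 2 := by gcongr
        _ = 2 * b := by field_simp
    have hY : ((6 * k / d : ℕ) : ℝ) ≤ 12 * b := by
      calc ((6 * k / d : ℕ) : ℝ) ≤ 6 * k / d := by exact_mod_cast Nat.cast_div_le (α := ℝ)
        _ ≤ 12 * b := by
          rw [div_le_iff₀ (by exact_mod_cast hd)]
          linarith [(div_le_iff₀ hb₀).1 hdge]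
    push_cast
    linarith

end Parameters

section Solver

variable {n k : ℕ} {w : Fin n → ℤ}

/-- The number of phases that find a maximum weight common base in rank `k`. -/
def phaseCount (k : ℕ) (w : Fin n → ℤ) : ℕ := Nat.log 2 ((k + 1) * maxAbsWeight w) + 1

lemma phaseCount_le {r W : ℕ} (hr : 0 < r) (hk : k ≤ 2 * r) (hW : 0 < W)
    (hw : maxAbsWeight w ≤ W) : (phaseCount k w : ℝ) ≤ 5 * max 1 (Real.log (W * r)) := by
  have hpos : 0 < W * r := Nat.mul_pos hW hr
  have hle : (k + 1) * maxAbsWeight w ≤ 3 * (W * r) := by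
    calc (k + 1) * maxAbsWeight w ≤ 3 * r * W := by gcongr; omega
      _ = 3 * (W * r) := by ring
  have hlog : (Nat.log 2 ((k + 1) * maxAbsWeight w) : ℝ) * Real.log 2 ≤
      Real.log 3 + Real.log (W * r) := by
    rw [← Real.log_pow, ← Real.log_mul (by norm_num) (by exact_mod_cast hpos.ne')]
    refine Real.log_le_log (by positivity) ?_
    exact_mod_cast Nat.pow_le_of_le_log (by positivity) (Nat.log_mono_right hle)
  have h2 := Real.log_two_gt_d9
  have h3 : Real.log 3 ≤ 2 * Real.log 2 := by
    rw [← Real.log_rpow two_pos]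
    exact Real.log_le_log (by norm_num) (by norm_num)
  have hone := le_max_left 1 (Real.log (W * r : ℝ))
  have hle := le_max_right 1 (Real.log (W * r : ℝ))
  rw [phaseCount]
  push_cast
  nlinarith

lemma abs_elim_zero_le (w : Fin n → ℤ) (e : Fin n ⊕ Fin k) :
    |Sum.elim w 0 e| ≤ maxAbsWeight w := by
  cases e with
  | inl e =>
    rw [Sum.elim_inl, Int.abs_eq_natAbs, Nat.cast_le]
    exact Finset.le_sup (f := fun e => (w e).natAbs) (Finset.mem_univ e)
  | inr e => simp

lemma exists_solver {Q A : Type} {o : Matroid (Fin n) → Matroid (Fin n) → Q → A}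
    {acc₁ acc₂ : Access Q A (Fin n ⊕ Fin k)} {t b : ℝ} {c : ℕ}
    (h₁ : ∀ M₁ M₂, acc₁.Correct (o M₁ M₂) (pad M₁ k) t c)
    (h₂ : ∀ M₁ M₂, acc₂.Correct (o M₁ M₂) (pad M₂ k) t c) (hk : 0 < k) (ht : 0 ≤ t)
    (htb : t ≤ b) (hb : 1 ≤ b) (hbt : ((n : ℝ) + k) * k * t ≤ b ^ 3) (w : Fin n → ℤ) :
    ∃ a : ParallelAlg Q A (Finset (Fin n)), ∀ M₁ M₂,
      a.Spec (o M₁ M₂) (phaseCount k w * (17 * b)) (c + c) (IsMaxWeightUpTo M₁ M₂ w k) := by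
  obtain ⟨d, X, Y, hXY, hcost⟩ := exists_phaseParams (n := n + k) hk ht hb (by exact_mod_cast hbt)
  have hbase (M : Matroid (Fin n)) :
      (pad M k).IsBase ((∅ : Finset (Fin n)).disjSum Finset.univ : Finset (Fin n ⊕ Fin k)) :=
    isBase_pad_iff.2 ⟨by rw [Finset.toLeft_disjSum]; simp, by simp⟩
  have hL (e : Fin n ⊕ Fin k) :
      ((k : ℤ) + 1) * |Sum.elim w 0 e| ≤ 2 * 2 ^ Nat.log 2 ((k + 1) * maxAbsWeight w) := by
    rw [← pow_succ']
    calc ((k : ℤ) + 1) * |Sum.elim w 0 e| ≤ (k + 1) * maxAbsWeight w := by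
          gcongr
          exact abs_elim_zero_le w e
      _ ≤ 2 ^ (Nat.log 2 ((k + 1) * maxAbsWeight w) + 1) := by
          exact_mod_cast (Nat.lt_pow_succ_log_self one_lt_two _).le
  refine ⟨(maxWeightBase acc₁ acc₂ k d X Y (Nat.log 2 ((k + 1) * maxAbsWeight w)) (Sum.elim w 0)
    ((∅ : Finset (Fin n)).disjSum Finset.univ)).map Finset.toLeft, fun M₁ M₂ => ?_⟩
  refine ((maxWeightBase_spec (h₁ M₁ M₂) (h₂ M₁ M₂) (eRank_pad M₁ k) (eRank_pad M₂ k)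
    (by simpa using hXY) (hbase M₁) (hbase M₂) hL).mono ?_ le_rfl fun _ => id).map
    fun B hB => hB.toLeft
  rw [phaseCount, Nat.cast_succ]
  gcongr
  linarith

end Solver

section Doubling

variable {Q A : Type} {o : Q → A} {n : ℕ}

/-- Call `solve` with cardinality bounds `k`, `2 * k`, `4 * k`, … until a bound is not attained, and
return that bound. At most `i` calls are made. -/
def doubling (solve : ℕ → ParallelAlg Q A (Finset (Fin n))) : ℕ → ℕ → ParallelAlg Q A ℕ
  | 0, k => .done k
  | i + 1, k => (solve k).bind fun S => if S.card < k then .done k else doubling solve i (2 * k)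

/-- The costs of the calls grow at least geometrically with ratio `6 / 5`, so that they add up to at
most `5` times the cost of the call that would come next. -/
lemma doubling_spec {solve : ℕ → ParallelAlg Q A (Finset (Fin n))} {β : ℕ → ℝ} {b : ℝ} {c r s : ℕ}
    (hsr : s ≤ r)
    (hsolve : ∀ k, 0 < k → k ≤ 2 * r → (solve k).Spec o (β k) c fun S => S.card = min k s)
    (hgrowth : ∀ k, 0 < k → k ≤ 2 * r → 6 / 5 * β k ≤ β (2 * k))
    (hb : ∀ k, s < k → k ≤ 4 * r → β k ≤ b) {i k : ℕ} (hk : 0 < k) (hkr : k ≤ 2 * r)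
    (hi : s < 2 ^ i * k) :
    (doubling solve i k).Spec o (5 * (b - β k)) c fun m => s < m ∧ m ≤ 2 * r := by
  induction i generalizing k with
  | zero =>
    rw [pow_zero, one_mul] at hi
    exact .done (by linarith [hb k hi (by omega)]) ⟨hi, hkr⟩
  | succ i ih =>
    have hratio := hgrowth k hk hkr
    obtain hsk | hks := lt_or_ge s k
    · refine ((hsolve k hk hkr).bind (t' := 0) fun S hS => ?_).mono ?_ le_rfl fun _ => id
      · rw [if_pos (hS.trans_lt ((min_le_right k s).trans_lt hsk))]
        exact .done le_rfl ⟨hsk, hkr⟩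
      · linarith [hb (2 * k) (by omega) (by omega)]
    · refine ((hsolve k hk hkr).bind (t' := 5 * (b - β (2 * k))) fun S hS => ?_).mono ?_ le_rfl
        fun _ => id
      · rw [if_neg (hS.trans (min_eq_left hks)).not_lt]
        exact ih (by omega) (by omega) (by rwa [pow_succ, mul_assoc] at hi)
      · linarith

end Doubling

section Algorithm

variable {Q A : Type} {n : ℕ} {w : Fin n → ℤ} {t : ℕ → ℕ} {b : ℕ → ℝ}
  {o : Matroid (Fin n) → Matroid (Fin n) → Q → A}
  {acc₁ acc₂ : (k : ℕ) → Access Q A (Fin n ⊕ Fin k)}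

/-- If the operations of the access to the padded matroids take `t k` rounds, then a phase in rank
`k` can be carried out in `17 * b k` rounds, and `b` grows geometrically. -/
structure PhaseBound (n : ℕ) (t : ℕ → ℕ) (b : ℕ → ℝ) : Prop where
  one_le : ∀ k, 0 < k → k ≤ 2 * n → 1 ≤ b k
  le : ∀ k, 0 < k → k ≤ 2 * n → t k ≤ b k
  le_pow : ∀ k, 0 < k → k ≤ 2 * n → ((n : ℝ) + k) * k * t k ≤ b k ^ 3
  growth : ∀ k, 0 < k → k ≤ 2 * n → 6 / 5 * b k ≤ b (2 * k)

lemma PhaseBound.exists_solvers (hb : PhaseBound n t b)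
    (h₁ : ∀ k, 0 < k → ∀ M₁ M₂, (acc₁ k).Correct (o M₁ M₂) (pad M₁ k) (t k) (2 * (n + k) ^ 2))
    (h₂ : ∀ k, 0 < k → ∀ M₁ M₂, (acc₂ k).Correct (o M₁ M₂) (pad M₂ k) (t k) (2 * (n + k) ^ 2))
    (w : Fin n → ℤ) : ∃ solve : ℕ → ParallelAlg Q A (Finset (Fin n)),
      ∀ W r k, 0 < W → maxAbsWeight w ≤ W → r ≤ n → 0 < k → k ≤ 2 * r → ∀ M₁ M₂,
        (solve k).Spec (o M₁ M₂) (85 * max 1 (Real.log (W * r)) * b k) (36 * n ^ 2)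
          (IsMaxWeightUpTo M₁ M₂ w k) := by
  have : Nonempty (ParallelAlg Q A (Finset (Fin n))) := ⟨.done ∅⟩
  choose! solve hsolve using fun k (hk : 0 < k) (hkn : k ≤ 2 * n) =>
    exists_solver (h₁ k hk) (h₂ k hk) hk (Nat.cast_nonneg _) (hb.le k hk hkn) (hb.one_le k hk hkn)
      (hb.le_pow k hk hkn) w
  refine ⟨solve, fun W r k hW hw hrn hk hkr M₁ M₂ => ?_⟩
  have hkn : k ≤ 2 * n := by omega
  refine (hsolve k hk hkn M₁ M₂).mono ?_ (by nlinarith) fun _ => id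
  have := hb.one_le k hk hkn
  calc phaseCount k w * (17 * b k) ≤ 5 * max 1 (Real.log (W * r)) * (17 * b k) := by
        gcongr
        exact phaseCount_le (by omega) hkr hW hw
    _ = 85 * max 1 (Real.log (W * r)) * b k := by ring

lemma isMaxWeight_empty (hw : maxAbsWeight w = 0) (M₁ M₂ : Matroid (Fin n)) :
    IsMaxWeight M₁ M₂ w ∅ := by
  have hzero (e : Fin n) : w e = 0 :=
    Int.natAbs_eq_zero.1 (Finset.sup_eq_bot_iff _ _ |>.1 hw e (Finset.mem_univ e))
  exact ⟨by simp [CommonIndep], by simp [hzero]⟩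

lemma PhaseBound.exists_algorithm (hb : PhaseBound n t b)
    (h₁ : ∀ k, 0 < k → ∀ M₁ M₂, (acc₁ k).Correct (o M₁ M₂) (pad M₁ k) (t k) (2 * (n + k) ^ 2))
    (h₂ : ∀ k, 0 < k → ∀ M₁ M₂, (acc₂ k).Correct (o M₁ M₂) (pad M₂ k) (t k) (2 * (n + k) ^ 2))
    (w : Fin n → ℤ) : ∃ alg : ParallelAlg Q A (Finset (Fin n)), ∀ M₁ M₂ r B,
      r = max 1 (commonRank M₁ M₂) → 0 ≤ B → (r ≤ n → ∀ k, r ≤ k → k ≤ 4 * r → b k ≤ B) →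
        alg.Spec (o M₁ M₂) (510 * (B * max 1 (Real.log (maxAbsWeight w * r)))) (36 * n ^ 2)
          (IsMaxWeight M₁ M₂ w) := by
  obtain hw | hw := (maxAbsWeight w).eq_zero_or_pos
  · refine ⟨.done ∅, fun M₁ M₂ r B _ hB _ => .done ?_ (isMaxWeight_empty hw M₁ M₂)⟩
    positivity
  obtain ⟨count, hcount⟩ := hb.exists_solvers h₁ h₂ 1
  obtain ⟨solve, hsolve⟩ := hb.exists_solvers h₁ h₂ w
  have hn : 0 < n := Nat.pos_of_ne_zero fun hn => by subst hn; simp [maxAbsWeight] at hw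
  refine ⟨(doubling count n 1).bind solve, fun M₁ M₂ r B hr hB hbB => ?_⟩
  have hs := commonRank_le M₁ M₂
  set s := commonRank M₁ M₂
  set Λ := max 1 (Real.log (maxAbsWeight w * r))
  have hΛ : 0 < Λ := lt_max_of_lt_left one_pos
  have hrn : r ≤ n := by omega
  have hone : maxAbsWeight (1 : Fin n → ℤ) ≤ maxAbsWeight w :=
    (Finset.sup_le fun e _ => by simp : maxAbsWeight (1 : Fin n → ℤ) ≤ 1).trans hw
  have hbB (k : ℕ) (hsk : s < k) (hkr : k ≤ 4 * r) : 85 * Λ * b k ≤ 85 * Λ * B := by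
    gcongr
    exact hbB hrn k (by omega) hkr
  have hdoubling := doubling_spec (o := o M₁ M₂) (β := fun k => 85 * Λ * b k)
    (i := n) (by omega : s ≤ r)
    (fun k hk hkr => (hcount _ r k hw hone hrn hk hkr M₁ M₂).mono le_rfl le_rfl
      fun S hS => hS.card_eq)
    (fun k hk hkr => by nlinarith [hb.growth k hk (by omega)]) hbB
    one_pos (by omega) (hs.trans_lt (by rw [mul_one]; exact Nat.lt_two_pow_self))
  refine (hdoubling.bind fun k hk => ((hsolve _ r k hw le_rfl hrn (by omega) hk.2 M₁ M₂).mono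
    (hbB k hk.1 (by omega)) le_rfl fun S hS => hS.isMaxWeight hk.1.le)).mono
    ?_ le_rfl fun _ => id
  have := mul_pos hΛ (zero_lt_one.trans_le (hb.one_le 1 one_pos (by omega)))
  linarith

end Algorithm

section Bounds

lemma rpow_third_pow {x : ℝ} (hx : 0 ≤ x) : (x ^ (1 / 3 : ℝ)) ^ 3 = x := by
  rw [← Real.rpow_natCast, ← Real.rpow_mul hx]
  norm_num

variable {n k r : ℕ}

lemma phaseBound_rank (n : ℕ) :
    PhaseBound n (fun _ => 1) fun k => (3 * n * k : ℝ) ^ (1 / 3 : ℝ) := by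
  have hone (k : ℕ) (hk : 0 < k) (hkn : k ≤ 2 * n) : 1 ≤ (3 * n * k : ℝ) ^ (1 / 3 : ℝ) := by
    refine Real.one_le_rpow ?_ (by norm_num)
    exact_mod_cast (by nlinarith [(by omega : 1 ≤ n)] : 1 ≤ 3 * n * k)
  refine ⟨hone, fun k hk hkn => by exact_mod_cast hone k hk hkn, fun k _ hkn => ?_, fun k _ _ => ?_⟩
  · have hkn : (k : ℝ) ≤ 2 * n := by exact_mod_cast hkn
    rw [rpow_third_pow (by positivity), Nat.cast_one, mul_one]
    gcongr
    linarith
  · have hgrowth : (6 / 5 : ℝ) ≤ 2 ^ (1 / 3 : ℝ) := by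
      refine le_of_pow_le_pow_left₀ three_ne_zero (by positivity) ?_
      rw [rpow_third_pow zero_le_two]
      norm_num
    calc 6 / 5 * (3 * n * k : ℝ) ^ (1 / 3 : ℝ)
        ≤ 2 ^ (1 / 3 : ℝ) * (3 * n * k : ℝ) ^ (1 / 3 : ℝ) := by gcongr
      _ = (3 * n * (2 * k : ℕ) : ℝ) ^ (1 / 3 : ℝ) := by
        rw [← Real.mul_rpow zero_le_two (by positivity)]
        push_cast
        ring_nf

lemma rankBound_le (hkr : k ≤ 4 * r) :
    (3 * n * k : ℝ) ^ (1 / 3 : ℝ) ≤ 60 * (n ^ (1 / 3 : ℝ) * r ^ (1 / 3 : ℝ)) := by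
  have hkr : (k : ℝ) ≤ 4 * r := by exact_mod_cast hkr
  refine le_of_pow_le_pow_left₀ three_ne_zero (by positivity) ?_
  rw [mul_pow, mul_pow, rpow_third_pow (by positivity), rpow_third_pow (by positivity),
    rpow_third_pow (by positivity)]
  nlinarith [mul_le_mul_of_nonneg_left hkr (Nat.cast_nonneg (α := ℝ) n),
    mul_nonneg (Nat.cast_nonneg (α := ℝ) n) (Nat.cast_nonneg (α := ℝ) r)]

lemma searchRounds_le {N : ℕ} (hk : 0 < k) (hkN : k ≤ N) :
    (searchRounds N k : ℝ) ≤ √k * (14 + 2 * Real.log (N / k)) := by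
  have hk₀ : (0 : ℝ) < k := by exact_mod_cast hk
  have hx : 0 ≤ Real.log (N / k) :=
    Real.log_nonneg ((one_le_div hk₀).2 (by exact_mod_cast hkN))
  have hone : 1 ≤ √(k : ℝ) := Real.one_le_sqrt.2 (by exact_mod_cast hk)
  have hs₀ : (0 : ℝ) < Nat.sqrt k := by exact_mod_cast Nat.sqrt_pos.2 hk
  have hs : (Nat.sqrt k : ℝ) ≤ √k := Real.nat_sqrt_le_real_sqrt
  have hdiv : (k : ℝ) / Nat.sqrt k ≤ Nat.sqrt k + 2 := by
    rw [div_le_iff₀ hs₀]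
    exact_mod_cast (Nat.sqrt_le_add k).trans (by nlinarith)
  have hlarge : (largeSteps N k : ℝ) ≤ √k * (4 + 2 * Real.log (N / k)) := by
    have hpot : searchPotential (Nat.sqrt k) k 0 N =
        k / Nat.sqrt k + 2 * Nat.sqrt k * Real.log (N / k) := by
      rw [searchPotential, Nat.cast_zero, sub_zero]
    have hfloor := Nat.floor_le (a := searchPotential (Nat.sqrt k) k 0 N)
      (by rw [hpot]; positivity)
    have hmul := mul_le_mul_of_nonneg_right hs hx
    rw [largeSteps, Nat.cast_succ]
    linarith
  have hsmall : (smallSteps k : ℝ) ≤ √k * 10 := by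
    have hfloor := Nat.floor_le (a := 6 * √(2 * k : ℝ)) (by positivity)
    have hsqrt : √(2 * k : ℝ) ≤ 3 / 2 * √k := by
      rw [Real.sqrt_mul zero_le_two]
      gcongr
      rw [Real.sqrt_le_left (by norm_num)]
      norm_num
    rw [smallSteps, Nat.cast_succ]
    linarith
  rw [searchRounds, Nat.cast_add]
  linarith

/-- The number of rounds of independence queries of a phase in rank `k`, up to a constant factor. -/
noncomputable def indepBound (n k : ℕ) : ℝ :=
  (3 * n : ℝ) ^ (1 / 3 : ℝ) * (√k * (14 + 2 * Real.log (3 * n / k)))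

lemma log_three_mul_div_nonneg (hk : 0 < k) (hkn : k ≤ 2 * n) : 0 ≤ Real.log (3 * n / k) := by
  refine Real.log_nonneg ((one_le_div (by exact_mod_cast hk)).2 ?_)
  exact_mod_cast (by omega : k ≤ 3 * n)

lemma searchRounds_add_le (hk : 0 < k) (hkn : k ≤ 2 * n) :
    (searchRounds (n + k) k : ℝ) ≤ √k * (14 + 2 * Real.log (3 * n / k)) := by
  refine (searchRounds_le hk (Nat.le_add_left k n)).trans ?_
  gcongr
  exact_mod_cast (by omega : n + k ≤ 3 * n)

lemma indepBound_growth (hk : 0 < k) (hkn : k ≤ 2 * n) :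
    6 / 5 * indepBound n k ≤ indepBound n (2 * k) := by
  have : (0 : ℝ) < k := by exact_mod_cast hk
  have hn₀ : (0 : ℝ) < n := by exact_mod_cast (by omega : 0 < n)
  have hx := log_three_mul_div_nonneg hk hkn
  have hlog : Real.log (3 * n / (2 * k : ℕ)) = Real.log (3 * n / k) - Real.log 2 := by
    rw [← Real.log_div (by positivity) two_ne_zero, Nat.cast_mul, Nat.cast_ofNat, div_div,
      mul_comm (2 : ℝ)]
  have hsqrt : 7 / 5 * √(k : ℝ) ≤ √(2 * k : ℕ) := by
    rw [Nat.cast_mul, Nat.cast_ofNat, Real.sqrt_mul zero_le_two]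
    gcongr
    exact Real.le_sqrt_of_sq_le (by norm_num)
  rw [indepBound, indepBound, hlog]
  set x := Real.log (3 * n / k)
  have hlog₂ := Real.log_two_lt_d9
  calc 6 / 5 * ((3 * n : ℝ) ^ (1 / 3 : ℝ) * (√k * (14 + 2 * x)))
      = (3 * n : ℝ) ^ (1 / 3 : ℝ) * (√k * (6 / 5 * (14 + 2 * x))) := by ring
    _ ≤ (3 * n : ℝ) ^ (1 / 3 : ℝ) * (√k * (7 / 5 * (14 + 2 * (x - Real.log 2)))) := by
      have : 6 / 5 * (14 + 2 * x) ≤ 7 / 5 * (14 + 2 * (x - Real.log 2)) := by linarith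
      gcongr
    _ = (3 * n : ℝ) ^ (1 / 3 : ℝ) * (7 / 5 * √k * (14 + 2 * (x - Real.log 2))) := by ring
    _ ≤ _ := by
      gcongr
      linarith

lemma phaseBound_indep (n : ℕ) : PhaseBound n (fun k => searchRounds (n + k) k) (indepBound n) := by
  have hcbrt (k : ℕ) (hk : 0 < k) (hkn : k ≤ 2 * n) : 1 ≤ (3 * n : ℝ) ^ (1 / 3 : ℝ) :=
    Real.one_le_rpow (by exact_mod_cast (by omega : 1 ≤ 3 * n)) (by norm_num)
  have hfactor (k : ℕ) (hk : 0 < k) (hkn : k ≤ 2 * n) :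
      1 ≤ √(k : ℝ) * (14 + 2 * Real.log (3 * n / k)) :=
    one_le_mul_of_one_le_of_one_le (Real.one_le_sqrt.2 (by exact_mod_cast hk))
      (by linarith [log_three_mul_div_nonneg hk hkn])
  refine ⟨fun k hk hkn => one_le_mul_of_one_le_of_one_le (hcbrt k hk hkn) (hfactor k hk hkn),
    fun k hk hkn => (searchRounds_add_le hk hkn).trans
      (le_mul_of_one_le_left (zero_le_one.trans (hfactor k hk hkn)) (hcbrt k hk hkn)),
    fun k hk hkn => ?_, fun k => indepBound_growth⟩
  have hkn' : (k : ℝ) ≤ 2 * n := by exact_mod_cast hkn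
  have hx := log_three_mul_div_nonneg hk hkn
  have ht := searchRounds_add_le hk hkn
  set x := Real.log (3 * n / k)
  calc ((n : ℝ) + k) * k * searchRounds (n + k) k
      ≤ 3 * n * k * (√k * (14 + 2 * x)) := by gcongr; linarith
    _ ≤ 3 * n * k * (√k * (14 + 2 * x) ^ 3) := by
      gcongr
      exact le_self_pow₀ (by linarith) three_ne_zero
    _ = ((3 * n : ℝ) ^ (1 / 3 : ℝ)) ^ 3 * (√k ^ 2 * √k * (14 + 2 * x) ^ 3) := by
      rw [rpow_third_pow (by positivity), Real.sq_sqrt (by positivity)]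
      ring
    _ = indepBound n k ^ 3 := by
      rw [indepBound]
      ring

lemma indepBound_le (hr : 0 < r) (hrn : r ≤ n) (hrk : r ≤ k) (hkr : k ≤ 4 * r) :
    indepBound n k ≤
      60 * (n ^ (1 / 3 : ℝ) * r ^ (1 / 2 : ℝ) * max 1 (Real.log (n / r))) := by
  have : (0 : ℝ) < r := by exact_mod_cast hr
  have hn₀ : (0 : ℝ) < n := by exact_mod_cast hr.trans_le hrn
  have hk₀ : (0 : ℝ) < k := by exact_mod_cast hr.trans_le hrk
  have hcbrt : (3 * n : ℝ) ^ (1 / 3 : ℝ) ≤ 3 / 2 * n ^ (1 / 3 : ℝ) := by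
    refine le_of_pow_le_pow_left₀ three_ne_zero (by positivity) ?_
    rw [mul_pow, rpow_third_pow (by positivity), rpow_third_pow (by positivity)]
    linarith
  have hsqrt : √(k : ℝ) ≤ 2 * √r := by
    rw [← Real.sqrt_sq zero_le_two, ← Real.sqrt_mul (by positivity)]
    exact Real.sqrt_le_sqrt (by norm_num; exact_mod_cast hkr)
  have hlog : Real.log (3 * n / k) ≤ 2 + Real.log (n / r) := by
    calc Real.log (3 * n / k) ≤ Real.log (3 * (n / r)) := by
          rw [← mul_div_assoc]
          gcongr
      _ = Real.log 3 + Real.log (n / r) := Real.log_mul (by norm_num) (by positivity)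
      _ ≤ 2 + Real.log (n / r) := by
          linarith [Real.log_le_sub_one_of_pos (zero_lt_three (α := ℝ))]
  set Λ := max 1 (Real.log (n / r : ℝ))
  have hfactor : 14 + 2 * Real.log (3 * n / k) ≤ 20 * Λ := by
    linarith [le_max_left 1 (Real.log (n / r : ℝ)), le_max_right 1 (Real.log (n / r : ℝ))]
  have : 0 < Λ := lt_max_of_lt_left one_pos
  rw [indepBound, ← Real.sqrt_eq_rpow]
  calc (3 * n : ℝ) ^ (1 / 3 : ℝ) * (√k * (14 + 2 * Real.log (3 * n / k)))
      ≤ (3 * n : ℝ) ^ (1 / 3 : ℝ) * (√k * (20 * Λ)) := by gcongr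
    _ ≤ 3 / 2 * n ^ (1 / 3 : ℝ) * (2 * √r * (20 * Λ)) := by gcongr
    _ = 60 * (n ^ (1 / 3 : ℝ) * √r * Λ) := by ring

end Bounds

section Oracles

variable {n : ℕ}

lemma exists_rankAlg (w : Fin n → ℤ) : ∃ alg : RankAlg n, ∀ M₁ M₂ r,
    r = max 1 (commonRank M₁ M₂) →
      alg.Spec (rankOracle M₁ M₂)
        (30600 * n ^ (1 / 3 : ℝ) * r ^ (1 / 3 : ℝ) * max 1 (Real.log (maxAbsWeight w * r)))
        (36 * n ^ 2) (IsMaxWeight M₁ M₂ w) := by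
  obtain ⟨alg, halg⟩ := (phaseBound_rank n).exists_algorithm (o := rankOracle)
    (acc₁ := fun k => padAccessRank k Sum.inl) (acc₂ := fun k => padAccessRank k Sum.inr)
    (fun k _ M₁ M₂ => by simpa only [Fintype.card_fin, Nat.cast_one] using
      padAccessRank_correct (o := rankOracle M₁ M₂) (f := Sum.inl) fun X => rfl)
    (fun k _ M₁ M₂ => by simpa only [Fintype.card_fin, Nat.cast_one] using
      padAccessRank_correct (o := rankOracle M₁ M₂) (f := Sum.inr) fun X => rfl) w
  refine ⟨alg, fun M₁ M₂ r hr => (halg M₁ M₂ r _ hr (by positivity) fun _ k _ hkr =>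
    rankBound_le hkr).mono (le_of_eq ?_) le_rfl fun _ => id⟩
  ring

lemma exists_indepAlg (w : Fin n → ℤ) : ∃ alg : IndepAlg n, ∀ M₁ M₂ r,
    r = max 1 (commonRank M₁ M₂) →
      alg.Spec (indepOracle M₁ M₂)
        (30600 * n ^ (1 / 3 : ℝ) * r ^ (1 / 2 : ℝ) * max 1 (Real.log (maxAbsWeight w * r)) *
          max 1 (Real.log (n / r)))
        (36 * n ^ 2) (IsMaxWeight M₁ M₂ w) := by
  obtain ⟨alg, halg⟩ := (phaseBound_indep n).exists_algorithm (o := indepOracle)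
    (acc₁ := fun k => padAccessIndep k Sum.inl) (acc₂ := fun k => padAccessIndep k Sum.inr)
    (fun k hk M₁ M₂ => by simpa only [Fintype.card_fin] using
      padAccessIndep_correct (o := indepOracle M₁ M₂) (f := Sum.inl) (by simp [indepOracle]) hk)
    (fun k hk M₁ M₂ => by simpa only [Fintype.card_fin] using
      padAccessIndep_correct (o := indepOracle M₁ M₂) (f := Sum.inr) (by simp [indepOracle]) hk) w
  refine ⟨alg, fun M₁ M₂ r hr => (halg M₁ M₂ r _ hr (by positivity) fun hrn k hrk hkr =>
    indepBound_le (by omega) hrn hrk hkr).mono (le_of_eq ?_) le_rfl fun _ => id⟩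
  ring

end Oracles

end MatroidIntersection

/-- The ground set of both matroids is the whole of `Fin n`; the algorithms know `n` and `w`, and
access the matroids through the oracles only. -/
theorem theorem1p4 :
    ∃ (C : ℝ) (c d : ℕ),
      (∃ alg : (n : ℕ) → (Fin n → ℤ) → MatroidIntersection.RankAlg n,
        ∀ (n : ℕ) (w : Fin n → ℤ) (M₁ M₂ : Matroid (Fin n)),
          M₁.E = Set.univ → M₂.E = Set.univ →
          ∀ W r : ℕ, W = MatroidIntersection.maxAbsWeight w →
            r = max 1 (MatroidIntersection.commonRank M₁ M₂) →
            MatroidIntersection.IsMaxWeight M₁ M₂ w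
              ((alg n w).output (MatroidIntersection.rankOracle M₁ M₂)) ∧
            ((alg n w).rounds (MatroidIntersection.rankOracle M₁ M₂) : ℝ) ≤
              C * (n : ℝ) ^ (1 / 3 : ℝ) * (r : ℝ) ^ (1 / 3 : ℝ) *
                max 1 (Real.log ((W : ℝ) * (r : ℝ))) ∧
            (alg n w).width (MatroidIntersection.rankOracle M₁ M₂) ≤ c * n ^ d) ∧
      (∃ alg : (n : ℕ) → (Fin n → ℤ) → MatroidIntersection.IndepAlg n,
        ∀ (n : ℕ) (w : Fin n → ℤ) (M₁ M₂ : Matroid (Fin n)),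
          M₁.E = Set.univ → M₂.E = Set.univ →
          ∀ W r : ℕ, W = MatroidIntersection.maxAbsWeight w →
            r = max 1 (MatroidIntersection.commonRank M₁ M₂) →
            MatroidIntersection.IsMaxWeight M₁ M₂ w
              ((alg n w).output (MatroidIntersection.indepOracle M₁ M₂)) ∧
            ((alg n w).rounds (MatroidIntersection.indepOracle M₁ M₂) : ℝ) ≤
              C * (n : ℝ) ^ (1 / 3 : ℝ) * (r : ℝ) ^ (1 / 2 : ℝ) *
                max 1 (Real.log ((W : ℝ) * (r : ℝ))) *
                max 1 (Real.log ((n : ℝ) / (r : ℝ))) ∧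
            (alg n w).width (MatroidIntersection.indepOracle M₁ M₂) ≤ c * n ^ d) := by
  choose rankAlg hrank using @MatroidIntersection.exists_rankAlg
  choose indepAlg hindep using @MatroidIntersection.exists_indepAlg
  refine ⟨30600, 36, 2, ⟨fun n w => rankAlg w, ?_⟩, fun n w => indepAlg w, ?_⟩
  · rintro n w M₁ M₂ - - _ r rfl hr
    have h := hrank w M₁ M₂ r hr
    exact ⟨h.output, h.rounds, h.width⟩
  · rintro n w M₁ M₂ - - _ r rfl hr
    have h := hindep w M₁ M₂ r hr
    exact ⟨h.output, h.rounds, h.width⟩
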